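/- Let $n\ge 1$ be an integer, let $\alpha>n$ be real, and let $R$ be a positive, continuous function on the unit sphere $\mathbb{S}^n\subset\mathbb{R}^{n+1}$ which is antipodally symmetric, that is, $R(-\xi)=R(\xi)$. Let $d\eta$ denote the standard surface measure on $\mathbb{S}^n$, let $|\xi-\eta|$ be the chordal distance (the Euclidean distance in $\mathbb{R}^{n+1}$), and let $[\alpha]$ be the integer part of $\alpha$. For $f\in L^1(\mathbb{S}^n)$ with $f>0$ almost everywhere put $$J_{\alpha,R}(f)=\frac{\int_{\mathbb{S}^n}\int_{\mathbb{S}^n}R(\xi)R(\eta)f(\xi)f(\eta)|\xi-\eta|^{\alpha-n}\,d\xi\,d\eta}{\Big(\int_{\mathbb{S}^n}f(\xi)^{\frac{2n}{n+\alpha}}R(\xi)\,d\xi\Big)^{\frac{n+\alpha}{n}}}.$$ Then there are positive, antipodally symmetric functions $u,f_\circ\in C^{[\alpha]-n}(\mathbb{S}^n)$ with $f_\circ=u^{\frac{n+\alpha}{n-\alpha}}$ such that (i) $u$ solves the integral equation $$u(\xi)=\int_{\mathbb{S}^n}R(\eta)\,u(\eta)^{\frac{n+\alpha}{n-\alpha}}\,|\xi-\eta|^{\alpha-n}\,d\eta\qquad\text{for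 all }\xi\in\mathbb{S}^n;$$ (ii) $f_\circ$ attains the infimum of $J_{\alpha,R}(f)$ over all $f\in L^1(\mathbb{S}^n)$ that are positive almost everywhere and satisfy $f(-\xi)=f(\xi)$ for almost every $\xi$. -/

import Mathlib

open MeasureTheory Set
open scoped Manifold ContDiff

noncomputable section

/-- The unit sphere `S^n` in `ℝ^{n+1}`. -/
abbrev UnitSphere (n : ℕ) : Type :=
  Metric.sphere (0 : EuclideanSpace ℝ (Fin (n + 1))) 1

/-- The standard surface measure on `S^n`, induced by Lebesgue measure on `ℝ^{n+1}`. -/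
def surfaceMeasure (n : ℕ) : Measure (UnitSphere n) :=
  (volume : Measure (EuclideanSpace ℝ (Fin (n + 1)))).toSphere

/-- The chordal distance `|ξ - η|`, measured in `ℝ^{n+1}`. -/
def chordalDist {n : ℕ} (ξ η : UnitSphere n) : ℝ :=
  ‖(ξ : EuclideanSpace ℝ (Fin (n + 1))) - (η : EuclideanSpace ℝ (Fin (n + 1)))‖

/-- `f(-ξ) = f(ξ)` for every `ξ`. -/
def AntipodallySymmetric {n : ℕ} (f : UnitSphere n → ℝ) : Prop :=
  ∀ ξ, f (-ξ) = f ξ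

/-- `u` is a positive solution of
`u(ξ) = ∫_{S^n} R(η) u(η)^{(n+α)/(n-α)} |ξ-η|^{α-n} dη`, for every `ξ ∈ S^n`. -/
def IsPositiveSolution {n : ℕ} (α : ℝ) (R u : UnitSphere n → ℝ) : Prop :=
  (∀ ξ, 0 < u ξ) ∧
    ∀ ξ, u ξ = ∫ η, R η * u η ^ (((n : ℝ) + α) / ((n : ℝ) - α)) *
      chordalDist ξ η ^ (α - (n : ℝ)) ∂(surfaceMeasure n)

/-- `H_{α,R}(f,f)`. -/
def energyH {n : ℕ} (α : ℝ) (R f : UnitSphere n → ℝ) : ℝ :=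
  ∫ η, ∫ ξ, R ξ * R η * f ξ * f η * chordalDist ξ η ^ (α - (n : ℝ))
    ∂(surfaceMeasure n) ∂(surfaceMeasure n)

/-- The weighted quasi-norm `(∫ f^{2n/(n+α)} R)^{(n+α)/(2n)}`, for `f > 0`. -/
def weightedNorm {n : ℕ} (α : ℝ) (R f : UnitSphere n → ℝ) : ℝ :=
  (∫ ξ, f ξ ^ (2 * (n : ℝ) / ((n : ℝ) + α)) * R ξ ∂(surfaceMeasure n)) ^
    (((n : ℝ) + α) / (2 * (n : ℝ)))

/-- The quotient functional `J_{α,R}`. -/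
def quotientJ {n : ℕ} (α : ℝ) (R f : UnitSphere n → ℝ) : ℝ :=
  energyH α R f / weightedNorm α R f ^ 2

/-- The positive antipodally symmetric elements of `L^1(S^n)`; as these are classes of functions
modulo null sets, both conditions are imposed almost everywhere. -/
def admissibleClass (n : ℕ) : Set (UnitSphere n → ℝ) :=
  {f | Integrable f (surfaceMeasure n) ∧ (∀ᵐ ξ ∂(surfaceMeasure n), 0 < f ξ) ∧
    ∀ᵐ ξ ∂(surfaceMeasure n), f (-ξ) = f ξ}

end

open Filter Topology

set_option linter.unusedSectionVars false

/-! Put β = α - n > 0, p = 2n/(n+α) ∈ (0,1) and dν = R dσ. The kernel |ξ-η|^β vanishes on the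
diagonal, but on even functions it acts like its even part K, the average of |ξ-η|^β and |ξ+η|^β.
Since 2ξ = (ξ-η) + (ξ+η), one of the two distances is at least 1, so K ≥ 1/2. It remains to minimize
E(f) = ∬ K f f dν dν over all f ≥ 0 with ∫ f^p dν = 1, for a continuous symmetric kernel bounded
below by a positive constant on a compact space. No symmetry constraint is imposed: K is even in
each variable, so the Euler-Lagrange equation makes the minimizer even.

Existence (`exists_nonneg_minimizer`). The lower bound on K bounds a minimizing sequence in L¹, and
Arzelà-Ascoli makes the potentials K g_j converge uniformly along a subsequence. Midpoints then have
nearly minimal energy, while strong concavity of t^p (`rpow_concavity_defect`) raises their power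
integral by a multiple of the squared L² distance between the functions g_j^{p/2}. Minimality makes
these Cauchy in L², so the constraint survives in the limit; Fatou bounds the limiting energy.

Euler-Lagrange (`exists_continuous_minimizer`). The minimizer f might vanish somewhere, so it cannot
be varied freely. Instead define g by m g^{p-1} = K f, which is continuous and positive, and set A =
∫ g^p dν. Moving from f towards g gives A ≤ 1; integrating the tangent inequality for t^p at g gives
A ≥ 1. Equality in the tangent inequality then yields f = g almost everywhere.

Regularity (`IsHomogeneousKernel.contDiff_integral`). The potential extends to ℝ^{n+1}. Each
derivative of |x|^β lowers the degree of homogeneity by one and can be taken under the integral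
while the degree is at least 1, because points are null for the surface measure. -/

/-! ### Scalar concavity inequalities for t ↦ t^p. -/

/-- Quantitative concavity of `t ↦ (1 - t) ^ p` at `0`. -/
theorem one_sub_rpow_le {p s : ℝ} (hp0 : 0 < p) (hp1 : p < 1) (hs0 : 0 ≤ s) (hs1 : s ≤ 1) :
    (1 - s) ^ p ≤ 1 - p * s - p * (1 - p) / 2 * s ^ 2 := by
  -- The defect vanishes at s = 0, so it suffices that its derivative is nonnegative, that is 1 +
  -- (1-p)x ≤ (1-x)^(p-1).
  have hmono : MonotoneOn (fun s : ℝ => 1 - p * s - p * (1 - p) / 2 * s ^ 2 - (1 - s) ^ p)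
      (Icc 0 1) := by
    have hderiv : ∀ x ∈ Ioo (0 : ℝ) 1,
        HasDerivAt (fun s : ℝ => 1 - p * s - p * (1 - p) / 2 * s ^ 2 - (1 - s) ^ p)
          (0 - p * 1 - p * (1 - p) / 2 * (2 * x) - (-1) * p * (1 - x) ^ (p - 1)) x := by
      intro x hx
      have h1 : HasDerivAt (fun s : ℝ => (1 - s) ^ p) ((-1) * p * (1 - x) ^ (p - 1)) x := by
        have := ((hasDerivAt_id x).const_sub 1).rpow_const (p := p)
          (Or.inl (by simp only [id]; linarith [hx.2]))
        simpa using this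
      have h2 : HasDerivAt (fun s : ℝ => s ^ 2) (2 * x) x := by
        simpa using hasDerivAt_pow 2 x
      exact (((hasDerivAt_const x 1).sub ((hasDerivAt_id x).const_mul p)).sub
        (h2.const_mul _)).sub h1
    apply monotoneOn_of_deriv_nonneg (convex_Icc 0 1)
    · have : Continuous (fun s : ℝ => (1 - s) ^ p) :=
        (continuous_const.sub continuous_id).rpow_const (fun x => Or.inr hp0.le)
      fun_prop
    · rw [interior_Icc]
      exact fun x hx => (hderiv x hx).differentiableAt.differentiableWithinAt
    · rw [interior_Icc]
      intro x hx
      rw [(hderiv x hx).deriv]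
      have hb : (1 - x) ^ (1 - p) ≤ 1 - (1 - p) * x := by
        have := rpow_one_add_le_one_add_mul_self (s := -x) (by linarith [hx.2])
          (p := 1 - p) (by linarith) (by linarith)
        calc (1 - x) ^ (1 - p) = (1 + -x) ^ (1 - p) := by ring_nf
          _ ≤ _ := this
          _ = _ := by ring
      have hpos : 0 < (1 - x) ^ (1 - p) := Real.rpow_pos_of_pos (by linarith [hx.2]) _
      have hinv : (1 - x) ^ (p - 1) = ((1 - x) ^ (1 - p))⁻¹ := by
        rw [← Real.rpow_neg (by linarith [hx.2])]; ring_nf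
      have hge : 1 + (1 - p) * x ≤ (1 - x) ^ (p - 1) := by
        rw [hinv, le_inv_comm₀ (by nlinarith [hx.1]) hpos]
        refine hb.trans ?_
        rw [← one_div, le_div_iff₀ (by nlinarith [hx.1])]
        nlinarith [sq_nonneg ((1 - p) * x)]
      nlinarith
  have := hmono (left_mem_Icc.2 zero_le_one) ⟨hs0, hs1⟩ hs0
  simp at this
  linarith

/-- The case of mean 1. Bernoulli for 1 + s and the quadratic gain for 1 - s leave at least
p(1-p)s²/4 on the right; the half powers differ by at most 2s, whence the constant 1/16. -/
theorem concavity_defect_aux {p s : ℝ} (hp0 : 0 < p) (hp1 : p < 1) (hs0 : 0 ≤ s) (hs1 : s ≤ 1) :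
    p * (1 - p) / 16 * ((1 + s) ^ (p / 2) - (1 - s) ^ (p / 2)) ^ 2 ≤
      1 - ((1 + s) ^ p + (1 - s) ^ p) / 2 := by
  have h1 := one_sub_rpow_le hp0 hp1 hs0 hs1
  have h2 := rpow_one_add_le_one_add_mul_self (s := s) (by linarith) hp0.le hp1.le
  have h3 := rpow_one_add_le_one_add_mul_self (s := s) (by linarith)
    (p := p / 2) (by linarith) (by linarith)
  have h4 : 1 - s ≤ (1 - s) ^ (p / 2) := by
    rcases hs1.eq_or_lt with rfl | h
    · simp [Real.zero_rpow (by positivity : p / 2 ≠ 0)]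
    · exact Real.self_le_rpow_of_le_one (by linarith) (by linarith) (by linarith)
  have h5 : (1 - s) ^ (p / 2) ≤ (1 + s) ^ (p / 2) :=
    Real.rpow_le_rpow (by linarith) (by linarith) (by linarith)
  have h6 : ((1 + s) ^ (p / 2) - (1 - s) ^ (p / 2)) ^ 2 ≤ (2 * s) ^ 2 :=
    pow_le_pow_left₀ (by linarith) (by nlinarith) 2
  have hpp : 0 < p * (1 - p) := by nlinarith
  nlinarith

/-- Strong concavity of `t ↦ t ^ p` on `[0, ∞)`, measured in the variable `t ^ (p / 2)`. -/
theorem rpow_concavity_defect {p a b : ℝ} (hp0 : 0 < p) (hp1 : p < 1) (ha : 0 ≤ a) (hb : 0 ≤ b) :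
    p * (1 - p) / 16 * (a ^ (p / 2) - b ^ (p / 2)) ^ 2 ≤
      ((a + b) / 2) ^ p - (a ^ p + b ^ p) / 2 := by
  wlog hab : b ≤ a generalizing a b
  · have := this hb ha (le_of_not_ge hab)
    rw [add_comm b a, add_comm (b ^ p)] at this
    convert this using 2
    ring
  rcases (add_nonneg ha hb).eq_or_lt with h0 | hpos
  · have ha0 : a = 0 := by linarith
    have hb0 : b = 0 := by linarith
    simp [ha0, hb0, Real.zero_rpow hp0.ne']
  set μ := (a + b) / 2 with hμ
  have hμ0 : 0 < μ := by positivity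
  set s := (a - b) / (a + b) with hs
  have hs0 : 0 ≤ s := div_nonneg (by linarith) hpos.le
  have hs1 : s ≤ 1 := (div_le_one hpos).2 (by linarith)
  have ea : a = μ * (1 + s) := by rw [hμ, hs]; field_simp; ring
  have eb : b = μ * (1 - s) := by rw [hμ, hs]; field_simp; ring
  have key := concavity_defect_aux hp0 hp1 hs0 hs1
  have hsq : (μ ^ (p / 2)) ^ 2 = μ ^ p := by
    rw [← Real.rpow_natCast, ← Real.rpow_mul hμ0.le]; norm_num
  clear_value μ s
  rw [ea, eb, Real.mul_rpow hμ0.le (by linarith), Real.mul_rpow hμ0.le (by linarith),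
    Real.mul_rpow hμ0.le (by linarith), Real.mul_rpow hμ0.le (by linarith)]
  calc _ = μ ^ p * (p * (1 - p) / 16 * ((1 + s) ^ (p / 2) - (1 - s) ^ (p / 2)) ^ 2) := by
        rw [← hsq]; ring
    _ ≤ μ ^ p * (1 - ((1 + s) ^ p + (1 - s) ^ p) / 2) :=
        mul_le_mul_of_nonneg_left key (Real.rpow_nonneg hμ0.le _)
    _ = _ := by ring

/-- The concave function `t ↦ t ^ p` lies strictly below its tangent at `b`, except at `b`. -/
theorem rpow_lt_tangent {p a b : ℝ} (hp0 : 0 < p) (hp1 : p < 1) (ha : 0 ≤ a) (hb : 0 < b)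
    (hab : a ≠ b) : a ^ p < b ^ p + p * (b ^ (p - 1) * (a - b)) := by
  have h := rpow_one_add_lt_one_add_mul_self (s := a / b - 1) (by
    have := div_nonneg ha hb.le; linarith) (by
      intro h; apply hab; field_simp at h; linarith) hp0 hp1
  have e : b ^ p = b ^ (p - 1) * b := by
    rw [Real.rpow_sub_one hb.ne']; field_simp
  rw [add_sub_cancel, Real.div_rpow ha hb.le, div_lt_iff₀ (Real.rpow_pos_of_pos hb p)] at h
  refine h.trans_eq ?_
  rw [e]; field_simp

theorem rpow_le_tangent {p a b : ℝ} (hp0 : 0 < p) (hp1 : p < 1) (ha : 0 ≤ a) (hb : 0 < b) :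
    a ^ p ≤ b ^ p + p * (b ^ (p - 1) * (a - b)) := by
  rcases eq_or_ne a b with rfl | h
  · simp
  · exact (rpow_lt_tangent hp0 hp1 ha hb h).le

/-! ### Potentials and energies of a continuous kernel. -/

section Potential

variable {X : Type*} [MetricSpace X] [CompactSpace X] [MeasurableSpace X] [BorelSpace X]
  {ν : Measure X} [IsFiniteMeasure ν] {K : X → X → ℝ} {f g w : X → ℝ} {p c : ℝ}

/-- The potential `x ↦ ∫ K(x, y) f(y) dν(y)`. -/
noncomputable def potential (ν : Measure X) (K : X → X → ℝ) (f : X → ℝ) (x : X) : ℝ :=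
  ∫ y, K x y * f y ∂ν

/-- The bilinear energy `∫ f(x) K(x, y) g(y) dν(y) dν(x)`. -/
noncomputable def pairing (ν : Measure X) (K : X → X → ℝ) (f g : X → ℝ) : ℝ :=
  ∫ x, f x * potential ν K g x ∂ν

theorem integrable_continuous_mul (hw : Continuous w) (hf : Integrable f ν) :
    Integrable (fun x => w x * f x) ν := by
  obtain ⟨C, hC⟩ := isCompact_univ.exists_bound_of_continuousOn hw.continuousOn
  exact hf.bdd_mul hw.measurable.aestronglyMeasurable (c := C)
    (Eventually.of_forall fun x => hC x (mem_univ x))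

theorem abs_potential_sub_le (hK : Continuous (Function.uncurry K)) (hf : Integrable f ν)
    (hf0 : ∀ x, 0 ≤ f x) {x x' : X} {ε : ℝ} (h : ∀ y, |K x y - K x' y| ≤ ε) :
    |potential ν K f x - potential ν K f x'| ≤ ε * ∫ y, f y ∂ν := by
  have hi : ∀ x, Integrable (fun y => K x y * f y) ν := fun x =>
    integrable_continuous_mul (hK.comp (Continuous.prodMk_right x)) hf
  unfold potential
  rw [← integral_sub (hi x) (hi x'), ← integral_const_mul, ← Real.norm_eq_abs]
  refine norm_integral_le_of_norm_le (hf.const_mul ε) (Eventually.of_forall fun y => ?_)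
  rw [← sub_mul, norm_mul, Real.norm_eq_abs, Real.norm_eq_abs, abs_of_nonneg (hf0 y)]
  exact mul_le_mul_of_nonneg_right (h y) (hf0 y)

theorem kernel_equicontinuous (hK : Continuous (Function.uncurry K)) {ε : ℝ}
    (hε : 0 < ε) : ∃ δ > 0, ∀ x x', dist x x' < δ → ∀ y, |K x y - K x' y| < ε := by
  obtain ⟨δ, hδ, h⟩ := Metric.uniformContinuous_iff.1
    (CompactSpace.uniformContinuous_of_continuous hK) ε hε
  refine ⟨δ, hδ, fun x x' hx y => ?_⟩
  have := h (a := (x, y)) (b := (x', y)) (by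
    rw [Prod.dist_eq]; exact max_lt hx (by simpa using hδ))
  simpa [Real.dist_eq] using this

/-- The modulus depends on f only through the bound M on its integral, which is the equicontinuity
needed for Arzelà-Ascoli. -/
theorem exists_modulus (hK : Continuous (Function.uncurry K)) {M ε : ℝ} (hM : 0 ≤ M)
    (hε : 0 < ε) : ∃ δ > 0, ∀ f : X → ℝ, Integrable f ν → (∀ x, 0 ≤ f x) → ∫ x, f x ∂ν ≤ M →
      ∀ x x', dist x x' < δ → |potential ν K f x - potential ν K f x'| < ε := by
  obtain ⟨δ, hδ, h⟩ := kernel_equicontinuous hK (ε := ε / (M + 1)) (by positivity)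
  refine ⟨δ, hδ, fun f hf hf0 hfM x x' hx => ?_⟩
  refine (abs_potential_sub_le hK hf hf0 fun y => (h x x' hx y).le).trans_lt ?_
  calc ε / (M + 1) * ∫ y, f y ∂ν ≤ ε / (M + 1) * M := by gcongr
    _ < ε / (M + 1) * (M + 1) := by gcongr; linarith
    _ = ε := by field_simp

theorem continuous_potential_of_nonneg (hK : Continuous (Function.uncurry K))
    (hf : Integrable f ν) (hf0 : ∀ x, 0 ≤ f x) : Continuous (potential ν K f) := by
  rw [Metric.continuous_iff]
  intro x ε hε
  obtain ⟨δ, hδ, h⟩ := exists_modulus (ν := ν) hK (integral_nonneg hf0) hε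
  exact ⟨δ, hδ, fun a ha => h f hf hf0 le_rfl a x ha⟩

theorem mul_integral_le_potential (hK : Continuous (Function.uncurry K)) (hcK : ∀ x y, c ≤ K x y)
    (hf : Integrable f ν) (hf0 : ∀ x, 0 ≤ f x) (x : X) :
    c * ∫ y, f y ∂ν ≤ potential ν K f x := by
  rw [← integral_const_mul]
  exact integral_mono (hf.const_mul c)
    (integrable_continuous_mul (hK.comp (Continuous.prodMk_right x)) hf)
    fun y => mul_le_mul_of_nonneg_right (hcK x y) (hf0 y)

theorem potential_add (hK : Continuous (Function.uncurry K))
    (hf : Integrable f ν) (hg : Integrable g ν) (a b : ℝ) (x : X) :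
    potential ν K (fun y => a * f y + b * g y) x =
      a * potential ν K f x + b * potential ν K g x := by
  have hi : ∀ f, Integrable f ν → Integrable (fun y => K x y * f y) ν := fun f hf =>
    integrable_continuous_mul (hK.comp (Continuous.prodMk_right x)) hf
  unfold potential
  rw [← integral_const_mul, ← integral_const_mul, ← integral_add ((hi f hf).const_mul a)
    ((hi g hg).const_mul b)]
  congr 1 with y
  ring

theorem pairing_comm (hK : Continuous (Function.uncurry K)) (hsymm : ∀ x y, K x y = K y x)
    (hf : Integrable f ν) (hg : Integrable g ν) : pairing ν K f g = pairing ν K g f := by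
  have hint : Integrable (Function.uncurry fun x y => f x * (K x y * g y)) (ν.prod ν) := by
    have h := integrable_continuous_mul hK (hf.mul_prod hg)
    refine h.congr (Eventually.of_forall fun z => ?_)
    simp only [Function.uncurry]; ring
  unfold pairing potential
  simp_rw [← integral_const_mul]
  rw [integral_integral_swap hint]
  congr 1 with y
  congr 1 with x
  rw [hsymm x y]; ring

theorem pairing_combination (hK : Continuous (Function.uncurry K)) (hsymm : ∀ x y, K x y = K y x)
    (hf : Integrable f ν) (hf0 : ∀ x, 0 ≤ f x) (hg : Integrable g ν) (hg0 : ∀ x, 0 ≤ g x)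
    (a b : ℝ) :
    pairing ν K (fun y => a * f y + b * g y) (fun y => a * f y + b * g y) =
      a ^ 2 * pairing ν K f f + 2 * a * b * pairing ν K g f + b ^ 2 * pairing ν K g g := by
  have hi : ∀ f g, Integrable f ν → Integrable g ν → (∀ x, 0 ≤ g x) →
      Integrable (fun x => f x * potential ν K g x) ν := fun f g hf hg hg0 => by
    simpa only [mul_comm] using
      integrable_continuous_mul (continuous_potential_of_nonneg hK hg hg0) hf
  have hfg := pairing_comm hK hsymm hf hg
  have e : pairing ν K (fun y => a * f y + b * g y) (fun y => a * f y + b * g y) =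
      a ^ 2 * pairing ν K f f + (a * b * pairing ν K f g + (a * b * pairing ν K g f +
        b ^ 2 * pairing ν K g g)) := by
    have h1 := (hi f f hf hf hf0).const_mul (a ^ 2)
    have h2 := (hi f g hf hg hg0).const_mul (a * b)
    have h3 := (hi g f hg hf hf0).const_mul (a * b)
    have h4 := (hi g g hg hg hg0).const_mul (b ^ 2)
    unfold pairing
    rw [← integral_const_mul, ← integral_const_mul, ← integral_const_mul, ← integral_const_mul,
      ← integral_add h3 h4]
    refine Eq.trans ?_ (congrArg _ (integral_add h2 (h3.add h4)))
    refine Eq.trans ?_ (integral_add h1 (h2.add (h3.add h4)))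
    congr 1 with x
    rw [potential_add hK hf hg]
    ring
  rw [e, hfg]; ring

theorem pairing_smul (t : ℝ) :
    pairing ν K (fun y => t * f y) (fun y => t * f y) = t ^ 2 * pairing ν K f f := by
  unfold pairing potential
  rw [← integral_const_mul]
  congr 1 with x
  have : ∀ y, K x y * (t * f y) = t * (K x y * f y) := fun y => by ring
  simp_rw [this, integral_const_mul]
  ring

theorem integrable_rpow_of_nonneg (hp0 : 0 ≤ p) (hp1 : p ≤ 1) (hf : Integrable f ν)
    (hf0 : ∀ x, 0 ≤ f x) : Integrable (fun x => f x ^ p) ν := by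
  refine (hf.add (integrable_const (1 : ℝ))).mono'
    ((Real.continuous_rpow_const hp0).comp_aestronglyMeasurable hf.1)
    (Eventually.of_forall fun x => ?_)
  rw [Real.norm_of_nonneg (Real.rpow_nonneg (hf0 x) p), Pi.add_apply]
  rcases le_total (f x) 1 with h | h
  · linarith [Real.rpow_le_one (hf0 x) h hp0, hf0 x]
  · have := Real.rpow_le_rpow_of_exponent_le h hp1
    rw [Real.rpow_one] at this
    linarith

end Potential

/-! ### Fatou's lemma and limits in mean square. -/

section Convergence

variable {X : Type*} [MeasurableSpace X] {ν : Measure X}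

/-- Fatou's lemma for real integrals; integrability of the limit is part of the conclusion. -/
theorem integral_le_of_tendsto_ae {h : ℕ → X → ℝ} {g : X → ℝ} {L : ℕ → ℝ} {l : ℝ}
    (hi : ∀ j, Integrable (h j) ν) (h0 : ∀ j x, 0 ≤ h j x)
    (hlim : ∀ᵐ x ∂ν, Tendsto (fun j => h j x) atTop (𝓝 (g x)))
    (hle : ∀ j, ∫ x, h j x ∂ν ≤ L j) (hL : Tendsto L atTop (𝓝 l)) :
    Integrable g ν ∧ ∫ x, g x ∂ν ≤ l := by
  have hg0 : 0 ≤ᵐ[ν] g := hlim.mono fun x hx => ge_of_tendsto' hx fun j => h0 j x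
  have hgm : AEStronglyMeasurable g ν := aestronglyMeasurable_of_tendsto_ae _ (fun j => (hi j).1) hlim
  have hl0 : 0 ≤ l := ge_of_tendsto' hL fun j => (integral_nonneg (h0 j)).trans (hle j)
  have hF : ∫⁻ x, ENNReal.ofReal (g x) ∂ν ≤ ENNReal.ofReal l := by
    calc ∫⁻ x, ENNReal.ofReal (g x) ∂ν
        = ∫⁻ x, liminf (fun j => ENNReal.ofReal (h j x)) atTop ∂ν := by
          refine lintegral_congr_ae (hlim.mono fun x hx => ?_)
          exact ((ENNReal.tendsto_ofReal hx).liminf_eq).symm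
      _ ≤ liminf (fun j => ∫⁻ x, ENNReal.ofReal (h j x) ∂ν) atTop :=
          lintegral_liminf_le' fun j => (hi j).1.aemeasurable.ennreal_ofReal
      _ ≤ liminf (fun j => ENNReal.ofReal (L j)) atTop := by
          refine liminf_le_liminf (Eventually.of_forall fun j => ?_)
          rw [← ofReal_integral_eq_lintegral_ofReal (hi j) (Eventually.of_forall (h0 j))]
          exact ENNReal.ofReal_le_ofReal (hle j)
      _ = ENNReal.ofReal l := (ENNReal.tendsto_ofReal hL).liminf_eq
  have hint : Integrable g ν :=
    ⟨hgm, (hasFiniteIntegral_iff_ofReal hg0).2 (hF.trans_lt ENNReal.ofReal_lt_top)⟩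
  refine ⟨hint, ?_⟩
  rwa [← ofReal_integral_eq_lintegral_ofReal hint hg0, ENNReal.ofReal_le_ofReal_iff hl0] at hF

theorem norm_sq_toLp_two {h : X → ℝ} (hh : MemLp h 2 ν) :
    ‖hh.toLp h‖ ^ 2 = ∫ x, h x ^ 2 ∂ν := by
  rw [← real_inner_self_eq_norm_sq, L2.inner_def]
  refine integral_congr_ae (hh.coeFn_toLp.mono fun x hx => ?_)
  simp [hx, sq]

/-- A sequence that is Cauchy in mean square has a mean square limit, attained almost everywhere
along a subsequence. -/
theorem exists_limit_of_cauchy_meanSquare {h : ℕ → X → ℝ} (hh : ∀ j, MemLp (h j) 2 ν)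
    (hc : ∀ ε > 0, ∃ N, ∀ i ≥ N, ∀ j ≥ N, ∫ x, (h i x - h j x) ^ 2 ∂ν < ε) :
    ∃ k : X → ℝ, ∃ φ : ℕ → ℕ, StrictMono φ ∧
      (∀ᵐ x ∂ν, Tendsto (fun j => h (φ j) x) atTop (𝓝 (k x))) ∧
      Tendsto (fun j => ∫ x, h j x ^ 2 ∂ν) atTop (𝓝 (∫ x, k x ^ 2 ∂ν)) := by
  set H : ℕ → Lp ℝ 2 ν := fun j => (hh j).toLp (h j) with hH
  have hcs : CauchySeq H := by
    rw [Metric.cauchySeq_iff]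
    intro ε hε
    obtain ⟨N, hN⟩ := hc (ε ^ 2) (by positivity)
    refine ⟨N, fun i hi j hj => ?_⟩
    have := hN i hi j hj
    rw [dist_eq_norm, hH]
    simp only
    rw [← MemLp.toLp_sub]
    refine lt_of_pow_lt_pow_left₀ 2 hε.le ?_
    rw [norm_sq_toLp_two]
    exact this
  obtain ⟨k, hk⟩ := cauchySeq_tendsto_of_complete hcs
  obtain ⟨φ, hφ, hae⟩ := (tendstoInMeasure_of_tendsto_Lp hk).exists_seq_tendsto_ae
  refine ⟨k, φ, hφ, ?_, ?_⟩
  · have : ∀ᵐ x ∂ν, ∀ j, H j x = h j x := ae_all_iff.2 fun j => (hh j).coeFn_toLp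
    filter_upwards [this, hae] with x hx hx'
    simpa only [hx] using hx'
  · have h1 := (hk.norm).pow 2
    have h2 : ‖k‖ ^ 2 = ∫ x, k x ^ 2 ∂ν := by
      conv_lhs => rw [← Lp.toLp_coeFn k (Lp.memLp k)]
      exact norm_sq_toLp_two _
    rw [h2] at h1
    simpa only [hH, norm_sq_toLp_two] using h1

end Convergence

/-! ### Compactness of potentials, coercivity and strong concavity. -/

section Minimizer

variable {X : Type*} [MetricSpace X] [CompactSpace X] [MeasurableSpace X] [BorelSpace X]
  {ν : Measure X} [IsFiniteMeasure ν] {K : X → X → ℝ} {f g w : X → ℝ} {p c : ℝ}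

/-- An L¹ bound gives no compactness for the functions themselves, but it makes their potentials
bounded and equicontinuous. -/
theorem exists_uniform_subseq_potential (hK : Continuous (Function.uncurry K))
    {g : ℕ → X → ℝ} {M : ℝ} (hg : ∀ j, Integrable (g j) ν) (hg0 : ∀ j x, 0 ≤ g j x)
    (hM : ∀ j, ∫ x, g j x ∂ν ≤ M) :
    ∃ u : X → ℝ, Continuous u ∧ ∃ φ : ℕ → ℕ, StrictMono φ ∧
      TendstoUniformly (fun j => potential ν K (g (φ j))) u atTop := by
  have hM0 : 0 ≤ M := (integral_nonneg (hg0 0)).trans (hM 0)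
  have hcont : ∀ j, Continuous (potential ν K (g j)) := fun j =>
    continuous_potential_of_nonneg hK (hg j) (hg0 j)
  let U : ℕ → BoundedContinuousFunction X ℝ := fun j =>
    BoundedContinuousFunction.mkOfCompact ⟨_, hcont j⟩
  obtain ⟨C, hC⟩ := isCompact_univ.exists_bound_of_continuousOn hK.continuousOn
  have hbound : ∀ j x, potential ν K (g j) x ∈ Metric.closedBall (0 : ℝ) (C * M) := by
    intro j x
    have hC0 : 0 ≤ C := (norm_nonneg _).trans (hC (x, x) (mem_univ _))
    rw [mem_closedBall_zero_iff]
    calc ‖potential ν K (g j) x‖ ≤ ∫ y, C * g j y ∂ν := by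
          refine norm_integral_le_of_norm_le ((hg j).const_mul C)
            (Eventually.of_forall fun y => ?_)
          rw [norm_mul, Real.norm_of_nonneg (hg0 j y)]
          exact mul_le_mul_of_nonneg_right (hC (x, y) (mem_univ _)) (hg0 j y)
      _ = C * ∫ y, g j y ∂ν := integral_const_mul _ _
      _ ≤ C * M := by gcongr; exact hM j
  have hcomp : IsCompact (closure (range U)) := by
    refine BoundedContinuousFunction.arzela_ascoli (Metric.closedBall (0 : ℝ) (C * M))
      (isCompact_closedBall _ _) (range U) ?_ ?_
    · rintro _ x ⟨j, rfl⟩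
      exact hbound j x
    · intro x
      rw [Metric.equicontinuousAt_iff]
      intro ε hε
      obtain ⟨δ, hδ, h⟩ := exists_modulus (ν := ν) hK hM0 hε
      refine ⟨δ, hδ, ?_⟩
      rintro x' hx' ⟨_, j, rfl⟩
      rw [Real.dist_eq]
      exact h (g j) (hg j) (hg0 j) (hM j) x x' (by rwa [dist_comm])
  obtain ⟨u, -, φ, hφ, hu⟩ := hcomp.tendsto_subseq
    (x := U) (fun j => subset_closure (mem_range_self j))
  exact ⟨u, u.continuous, φ, hφ, BoundedContinuousFunction.tendsto_iff_tendstoUniformly.1 hu⟩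

theorem integrable_mul_potential (hK : Continuous (Function.uncurry K)) (hf : Integrable f ν)
    (hg : Integrable g ν) (hg0 : ∀ x, 0 ≤ g x) :
    Integrable (fun x => f x * potential ν K g x) ν := by
  simpa only [mul_comm] using
    integrable_continuous_mul (continuous_potential_of_nonneg hK hg hg0) hf

theorem mul_sq_integral_le_pairing (hK : Continuous (Function.uncurry K))
    (hcK : ∀ x y, c ≤ K x y) (hf : Integrable f ν) (hf0 : ∀ x, 0 ≤ f x) :
    c * (∫ x, f x ∂ν) ^ 2 ≤ pairing ν K f f := by
  calc c * (∫ x, f x ∂ν) ^ 2 = ∫ x, f x * (c * ∫ y, f y ∂ν) ∂ν := by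
        rw [integral_mul_const]; ring
    _ ≤ pairing ν K f f := integral_mono (hf.mul_const _) (integrable_mul_potential hK hf hf hf0)
        fun x => mul_le_mul_of_nonneg_left (mul_integral_le_potential hK hcK hf hf0 x) (hf0 x)

/-- A normalized function cannot have small integral. -/
theorem exists_pos_le_integral (hp0 : 0 < p) (hp1 : p < 1) (ν : Measure X) [IsFiniteMeasure ν] :
    ∃ κ > 0, ∀ f : X → ℝ, Integrable f ν → (∀ x, 0 ≤ f x) → ∫ x, f x ^ p ∂ν = 1 →
      κ ≤ ∫ x, f x ∂ν := by
  set V := ν.real univ with hV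
  have hV0 : 0 ≤ V := measureReal_nonneg
  -- The tangent at b gives ∫ f^p ≤ V b^p + p b^(p-1) ∫ f; this b makes the first term at most 1/2.
  set b : ℝ := (2 * (V + 1))⁻¹ ^ p⁻¹ with hb
  have hb0 : 0 < b := by positivity
  have hbp : b ^ p = (2 * (V + 1))⁻¹ := Real.rpow_inv_rpow (by positivity) hp0.ne'
  have hb1 : 0 < b ^ (p - 1) := by positivity
  refine ⟨1 / (2 * (p * b ^ (p - 1))), by positivity, fun f hf hf0 h1 => ?_⟩
  have hle : ∫ x, f x ^ p ∂ν ≤ ∫ x, (b ^ p + p * b ^ (p - 1) * f x) ∂ν := by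
    refine integral_mono (integrable_rpow_of_nonneg hp0.le hp1.le hf hf0)
      ((integrable_const _).add (hf.const_mul _)) fun x => ?_
    have := rpow_le_tangent hp0 hp1 (hf0 x) hb0
    have h3 : 0 ≤ p * b ^ (p - 1) * b := by positivity
    simp only
    linarith
  rw [h1, integral_add (integrable_const _) (hf.const_mul _), integral_const, integral_const_mul,
    smul_eq_mul, ← hV, hbp] at hle
  have h4 : V * (2 * (V + 1))⁻¹ ≤ 1 / 2 := by
    rw [← div_eq_mul_inv, div_le_div_iff₀ (by positivity) (by positivity)]
    linarith
  rw [div_le_iff₀ (by positivity)]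
  linarith

/-- The power integral is strongly concave. -/
theorem meanSquare_le_integral_rpow_midpoint (hp0 : 0 < p) (hp1 : p < 1)
    (hf : Integrable f ν) (hf0 : ∀ x, 0 ≤ f x) (hg : Integrable g ν) (hg0 : ∀ x, 0 ≤ g x) :
    p * (1 - p) / 16 * ∫ x, (f x ^ (p / 2) - g x ^ (p / 2)) ^ 2 ∂ν ≤
      ∫ x, (1 / 2 * f x + 1 / 2 * g x) ^ p ∂ν -
        (∫ x, f x ^ p ∂ν + ∫ x, g x ^ p ∂ν) / 2 := by
  have hF := integrable_rpow_of_nonneg hp0.le hp1.le hf hf0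
  have hG := integrable_rpow_of_nonneg hp0.le hp1.le hg hg0
  have hmid0 : ∀ x, 0 ≤ 1 / 2 * f x + 1 / 2 * g x := fun x => by
    linarith [hf0 x, hg0 x]
  have hM : Integrable (fun x => (1 / 2 * f x + 1 / 2 * g x) ^ p) ν :=
    integrable_rpow_of_nonneg hp0.le hp1.le
      ((hf.const_mul (1 / 2)).add (hg.const_mul (1 / 2))) hmid0
  have hd : Integrable (fun x => (f x ^ p + g x ^ p) / 2) ν := (hF.add hG).div_const 2
  rw [← integral_add hF hG, ← integral_div, ← integral_sub hM hd, ← integral_const_mul]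
  refine integral_mono_of_nonneg (Eventually.of_forall fun x => ?_) (hM.sub hd)
    (Eventually.of_forall fun x => ?_)
  · have : 0 ≤ 1 - p := by linarith
    simp only [Pi.zero_apply]
    positivity
  · have := rpow_concavity_defect hp0 hp1 (hf0 x) (hg0 x)
    have e : 1 / 2 * f x + 1 / 2 * g x = (f x + g x) / 2 := by ring
    simpa only [e] using this

theorem rpow_half_sq {p a : ℝ} (ha : 0 ≤ a) : (a ^ (p / 2)) ^ 2 = a ^ p := by
  rw [← Real.rpow_natCast, ← Real.rpow_mul ha]; norm_num

theorem memLp_two_rpow_half (hp0 : 0 < p) (hp1 : p < 1)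
    (hf : Integrable f ν) (hf0 : ∀ x, 0 ≤ f x) : MemLp (fun x => f x ^ (p / 2)) 2 ν := by
  rw [memLp_two_iff_integrable_sq
    ((Real.continuous_rpow_const (by positivity)).comp_aestronglyMeasurable hf.1)]
  simpa only [rpow_half_sq (hf0 _)] using integrable_rpow_of_nonneg hp0.le hp1.le hf hf0

end Minimizer

/-! ### Existence of a minimizer. -/

section Existence

variable {X : Type*} [MetricSpace X] [CompactSpace X] [MeasurableSpace X] [BorelSpace X]
  {ν : Measure X} [IsFiniteMeasure ν] {K : X → X → ℝ} {f g w : X → ℝ} {p c : ℝ}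

/-- A sharp constant in the reversed inequality yields near-optimality of midpoints, hence that
minimizing sequences with uniformly convergent potentials are Cauchy. -/
theorem meanSquare_le_of_near_minimal (hK : Continuous (Function.uncurry K))
    (hsymm : ∀ x y, K x y = K y x) (hp0 : 0 < p) (hp1 : p < 1) {m M δ : ℝ} (hm : 0 < m)
    (hmin : ∀ g, Integrable g ν → (∀ x, 0 ≤ g x) →
      m * (∫ x, g x ^ p ∂ν) ^ (2 / p) ≤ pairing ν K g g)
    (hf : Integrable f ν) (hf0 : ∀ x, 0 ≤ f x) (hg : Integrable g ν) (hg0 : ∀ x, 0 ≤ g x)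
    (hf1 : ∫ x, f x ^ p ∂ν = 1) (hg1 : ∫ x, g x ^ p ∂ν = 1) (hgM : ∫ x, g x ∂ν ≤ M)
    (hδ : 0 ≤ δ)
    (hfE : pairing ν K f f ≤ m + δ) (hgE : pairing ν K g g ≤ m + δ)
    (hpot : ∀ x, |potential ν K f x - potential ν K g x| ≤ δ) :
    m * (p * (1 - p) / 16 * ∫ x, (f x ^ (p / 2) - g x ^ (p / 2)) ^ 2 ∂ν) ≤ (1 + M) * δ := by
  set D := p * (1 - p) / 16 * ∫ x, (f x ^ (p / 2) - g x ^ (p / 2)) ^ 2 ∂ν with hD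
  have hD0 : 0 ≤ D := by
    have : 0 ≤ 1 - p := by linarith
    have : 0 ≤ ∫ x, (f x ^ (p / 2) - g x ^ (p / 2)) ^ 2 ∂ν := integral_nonneg fun x => sq_nonneg _
    positivity
  -- Uniform closeness of the potentials controls the cross term, so the midpoint has energy at most
  -- m + (1 + M)δ.
  have hcross : pairing ν K g f ≤ pairing ν K g g + δ * M := by
    calc pairing ν K g f ≤ ∫ x, (g x * potential ν K g x + δ * g x) ∂ν := by
          refine integral_mono (integrable_mul_potential hK hg hf hf0)
            ((integrable_mul_potential hK hg hg hg0).add (hg.const_mul δ)) fun x => ?_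
          have := (abs_le.1 (hpot x)).2
          have := mul_le_mul_of_nonneg_left this (hg0 x)
          simp only
          linarith
      _ = pairing ν K g g + δ * ∫ x, g x ∂ν := by
          rw [integral_add (integrable_mul_potential hK hg hg hg0) (hg.const_mul δ),
            integral_const_mul]
          rfl
      _ ≤ _ := by gcongr
  have hmid := hmin (fun x => 1 / 2 * f x + 1 / 2 * g x)
    ((hf.const_mul (1 / 2)).add (hg.const_mul (1 / 2))) (fun x => by linarith [hf0 x, hg0 x])
  rw [pairing_combination hK hsymm hf hf0 hg hg0] at hmid
  have hconc := meanSquare_le_integral_rpow_midpoint hp0 hp1 hf hf0 hg hg0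
  rw [hf1, hg1, ← hD] at hconc
  have h2p : 1 ≤ 2 / p := by rw [le_div_iff₀ hp0]; linarith
  have hpow : 1 + D ≤ (∫ x, (1 / 2 * f x + 1 / 2 * g x) ^ p ∂ν) ^ (2 / p) := by
    calc 1 + D ≤ (1 + D) ^ (2 / p) := by
          simpa using Real.rpow_le_rpow_of_exponent_le (by linarith : 1 ≤ 1 + D) h2p
      _ ≤ _ := Real.rpow_le_rpow (by linarith) (by linarith) (by linarith)
  have hδM : 0 ≤ δ * M := mul_nonneg hδ ((integral_nonneg hg0).trans hgM)
  have := mul_le_mul_of_nonneg_left hpow hm.le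
  nlinarith

/-- The minimal energy of a normalized function exists, is positive, and controls the energy
of all nonnegative functions. -/
theorem exists_sharp_constant (hK : Continuous (Function.uncurry K)) (hc : 0 < c)
    (hcK : ∀ x y, c ≤ K x y) (hν : ν ≠ 0) (hp0 : 0 < p) (hp1 : p < 1) :
    ∃ m > 0, (∀ g, Integrable g ν → (∀ x, 0 ≤ g x) →
        m * (∫ x, g x ^ p ∂ν) ^ (2 / p) ≤ pairing ν K g g) ∧
      ∃ g : ℕ → X → ℝ, (∀ j, Integrable (g j) ν) ∧ (∀ j x, 0 ≤ g j x) ∧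
        (∀ j, ∫ x, g j x ^ p ∂ν = 1) ∧
        Tendsto (fun j => pairing ν K (g j) (g j)) atTop (𝓝 m) := by
  set S : Set ℝ := {e | ∃ g : X → ℝ, Integrable g ν ∧ (∀ x, 0 ≤ g x) ∧ ∫ x, g x ^ p ∂ν = 1 ∧
    pairing ν K g g = e} with hS
  -- Energy has degree 2 and the power integral degree p, so the factor (∫ g^p)^(-1/p) normalizes g.
  have hscale : ∀ g : X → ℝ, Integrable g ν → (∀ x, 0 ≤ g x) → 0 < ∫ x, g x ^ p ∂ν →
      ((∫ x, g x ^ p ∂ν) ^ (-(1 / p))) ^ 2 * pairing ν K g g ∈ S := by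
    intro g hg hg0 hpos
    set t := (∫ x, g x ^ p ∂ν) ^ (-(1 / p)) with ht
    have ht0 : 0 < t := Real.rpow_pos_of_pos hpos _
    refine ⟨fun x => t * g x, hg.const_mul t, fun x => mul_nonneg ht0.le (hg0 x), ?_,
      pairing_smul t⟩
    simp_rw [Real.mul_rpow ht0.le (hg0 _)]
    rw [integral_const_mul, ht, ← Real.rpow_mul hpos.le]
    have : -(1 / p) * p = -1 := by field_simp
    rw [this, Real.rpow_neg_one, inv_mul_cancel₀ hpos.ne']
  have hne : S.Nonempty := by
    refine ⟨_, hscale (fun _ => 1) (integrable_const _) (fun _ => zero_le_one) ?_⟩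
    simpa [measureReal_def, ENNReal.toReal_pos_iff, pos_iff_ne_zero] using hν
  obtain ⟨κ, hκ, hκle⟩ := exists_pos_le_integral hp0 hp1 ν
  have hlow : ∀ e ∈ S, c * κ ^ 2 ≤ e := by
    rintro _ ⟨g, hg, hg0, hg1, rfl⟩
    refine le_trans ?_ (mul_sq_integral_le_pairing hK hcK hg hg0)
    gcongr
    exact hκle g hg hg0 hg1
  have hbdd : BddBelow S := ⟨_, hlow⟩
  have hm : 0 < sInf S := (by positivity : 0 < c * κ ^ 2).trans_le (le_csInf hne hlow)
  refine ⟨sInf S, hm, fun g hg hg0 => ?_, ?_⟩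
  · have hnn : 0 ≤ ∫ x, g x ^ p ∂ν := integral_nonneg fun x => Real.rpow_nonneg (hg0 x) p
    rcases hnn.eq_or_lt with h | h
    · rw [← h, Real.zero_rpow (by positivity), mul_zero]
      exact le_trans (by positivity) (mul_sq_integral_le_pairing hK hcK hg hg0)
    · have := csInf_le hbdd (hscale g hg hg0 h)
      have hpow : ((∫ x, g x ^ p ∂ν) ^ (-(1 / p))) ^ 2 = ((∫ x, g x ^ p ∂ν) ^ (2 / p))⁻¹ := by
        rw [← Real.rpow_natCast, ← Real.rpow_mul h.le, ← Real.rpow_neg h.le]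
        congr 1; push_cast; ring
      rw [hpow, inv_mul_eq_div, le_div_iff₀ (Real.rpow_pos_of_pos h _)] at this
      exact this
  · obtain ⟨e, -, he, heS⟩ := exists_seq_tendsto_sInf hne hbdd
    choose g hg hg0 hg1 hgE using heS
    exact ⟨g, hg, hg0, hg1, by simpa only [hgE] using he⟩

/-- The sharp constant is attained by a nonnegative integrable function. -/
theorem exists_nonneg_minimizer (hK : Continuous (Function.uncurry K))
    (hsymm : ∀ x y, K x y = K y x) (hc : 0 < c)
    (hcK : ∀ x y, c ≤ K x y) (hν : ν ≠ 0) (hp0 : 0 < p) (hp1 : p < 1) :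
    ∃ m > 0, (∀ g, Integrable g ν → (∀ x, 0 ≤ g x) →
        m * (∫ x, g x ^ p ∂ν) ^ (2 / p) ≤ pairing ν K g g) ∧
      ∃ f, Integrable f ν ∧ (∀ x, 0 ≤ f x) ∧ ∫ x, f x ^ p ∂ν = 1 ∧ pairing ν K f f ≤ m := by
  obtain ⟨m, hm, hmin, g₀, hg₀, hg₀0, hg₀1, hE₀⟩ := exists_sharp_constant hK hc hcK hν hp0 hp1
  refine ⟨m, hm, hmin, ?_⟩
  obtain ⟨M, hM⟩ : ∃ M, ∀ j, ∫ x, g₀ j x ∂ν ≤ M := by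
    obtain ⟨B, hB⟩ := hE₀.bddAbove_range
    refine ⟨B / c + 1, fun j => ?_⟩
    have h1 : c * (∫ x, g₀ j x ∂ν) ^ 2 ≤ B :=
      (mul_sq_integral_le_pairing hK hcK (hg₀ j) (hg₀0 j)).trans (hB (mem_range_self j))
    have h2 : (∫ x, g₀ j x ∂ν) ^ 2 ≤ B / c := by rw [le_div_iff₀ hc]; linarith
    nlinarith [sq_nonneg (∫ x, g₀ j x ∂ν - 1)]
  have hM0 : 0 ≤ M := (integral_nonneg (hg₀0 0)).trans (hM 0)
  obtain ⟨u, hu, φ, hφ, hφu⟩ := exists_uniform_subseq_potential hK hg₀ hg₀0 hM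
  obtain ⟨g, hgdef⟩ : ∃ g : ℕ → X → ℝ, g = fun j => g₀ (φ j) := ⟨_, rfl⟩
  have hg : ∀ j, Integrable (g j) ν := fun j => hgdef ▸ hg₀ _
  have hg0 : ∀ j x, 0 ≤ g j x := fun j => hgdef ▸ hg₀0 _
  have hg1 : ∀ j, ∫ x, g j x ^ p ∂ν = 1 := fun j => hgdef ▸ hg₀1 _
  have hgM : ∀ j, ∫ x, g j x ∂ν ≤ M := fun j => hgdef ▸ hM _
  have hE : Tendsto (fun j => pairing ν K (g j) (g j)) atTop (𝓝 m) :=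
    hgdef ▸ hE₀.comp hφ.tendsto_atTop
  have hgu : TendstoUniformly (fun j => potential ν K (g j)) u atTop := hgdef ▸ hφu
  have hcauchy : ∀ ε > 0, ∃ N, ∀ i ≥ N, ∀ j ≥ N,
      ∫ x, (g i x ^ (p / 2) - g j x ^ (p / 2)) ^ 2 ∂ν < ε := by
    intro ε hε
    have hpp : 0 < p * (1 - p) / 16 := by have : 0 < 1 - p := by linarith
                                          positivity
    -- Chosen so that the midpoint estimate bounds the mean-square distance by ε/2.
    set δ := m * (p * (1 - p) / 16) * ε / (2 * (1 + M)) with hδ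
    have hδ0 : 0 < δ := by positivity
    obtain ⟨N, hN⟩ := eventually_atTop.1 ((Metric.tendstoUniformly_iff.1 hgu (δ / 2)
      (by positivity)).and (hE.eventually (gt_mem_nhds (by linarith : m < m + δ))))
    refine ⟨N, fun i hi j hj => ?_⟩
    have key := meanSquare_le_of_near_minimal hK hsymm hp0 hp1 hm hmin (hg i) (hg0 i) (hg j)
      (hg0 j) (hg1 i) (hg1 j) (hgM j) hδ0.le (hN i hi).2.le (hN j hj).2.le (fun x => by
        rw [← Real.dist_eq]
        have h1 := (hN i hi).1 x
        have h2 := (hN j hj).1 x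
        have := dist_triangle_left (potential ν K (g i) x) (potential ν K (g j) x) (u x)
        linarith)
    have e : (1 + M) * δ = m * (p * (1 - p) / 16) * (ε / 2) := by
      rw [hδ]; field_simp
    rw [e, ← mul_assoc] at key
    have := le_of_mul_le_mul_left key (by positivity)
    linarith
  obtain ⟨k, ψ, hψ, hae, hlim⟩ := exists_limit_of_cauchy_meanSquare
    (fun j => memLp_two_rpow_half hp0 hp1 (hg j) (hg0 j)) hcauchy
  -- The L² limit k of g_j^(p/2) is nonnegative only almost everywhere; the absolute value makes f
  -- nonnegative everywhere.
  set f : X → ℝ := fun x => |k x| ^ (2 / p) with hf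
  have hf0 : ∀ x, 0 ≤ f x := fun x => Real.rpow_nonneg (abs_nonneg _) _
  have hgf : ∀ᵐ x ∂ν, Tendsto (fun j => g (ψ j) x) atTop (𝓝 (f x)) := by
    filter_upwards [hae] with x hx
    have h1 := (hx.abs).rpow_const (p := 2 / p) (Or.inr (by positivity))
    refine h1.congr fun j => ?_
    rw [abs_of_nonneg (Real.rpow_nonneg (hg0 _ _) _), ← Real.rpow_mul (hg0 _ _)]
    have : p / 2 * (2 / p) = 1 := by field_simp
    rw [this, Real.rpow_one]
  have hfint : Integrable f ν :=
    (integral_le_of_tendsto_ae (fun j => hg (ψ j)) (fun j => hg0 (ψ j)) hgf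
      (fun j => hgM (ψ j)) tendsto_const_nhds).1
  -- Strong L² convergence preserves the constraint, since f^p = k².
  have hf1 : ∫ x, f x ^ p ∂ν = 1 := by
    have h1 : ∀ x, f x ^ p = k x ^ 2 := fun x => by
      rw [hf]; simp only
      rw [← Real.rpow_mul (abs_nonneg _)]
      have : 2 / p * p = (2 : ℕ) := by push_cast; field_simp
      rw [this, Real.rpow_natCast, sq_abs]
    simp_rw [h1]
    simp_rw [rpow_half_sq (hg0 _ _), hg1] at hlim
    exact tendsto_nhds_unique hlim tendsto_const_nhds
  have hu0 : ∀ x, 0 ≤ u x := fun x =>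
    ge_of_tendsto' (hgu.tendsto_at x) fun j => integral_nonneg fun y =>
      mul_nonneg (hc.le.trans (hcK x y)) (hg0 j y)
  -- Mass may be lost in L¹, so Fatou yields only an inequality; it has the direction needed for an
  -- upper bound on the energy.
  have hpot_le : ∀ x, potential ν K f x ≤ u x := fun x =>
    (integral_le_of_tendsto_ae (h := fun j y => K x y * g (ψ j) y)
      (fun j => integrable_continuous_mul (hK.comp (Continuous.prodMk_right x)) (hg (ψ j)))
      (fun j y => mul_nonneg (hc.le.trans (hcK x y)) (hg0 _ y))
      (hgf.mono fun y hy => hy.const_mul _)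
      (fun j => le_rfl) ((hgu.tendsto_at x).comp hψ.tendsto_atTop)).2
  have hgu_int : ∀ j, Integrable (fun x => u x * g j x) ν := fun j =>
    integrable_continuous_mul hu (hg j)
  have hlimE : Tendsto (fun j => ∫ x, u x * g j x ∂ν) atTop (𝓝 m) := by
    have hdiff : Tendsto (fun j => ∫ x, u x * g j x ∂ν - pairing ν K (g j) (g j)) atTop
        (𝓝 0) := by
      rw [Metric.tendsto_atTop]
      intro ε hε
      obtain ⟨N, hN⟩ := eventually_atTop.1 (Metric.tendstoUniformly_iff.1 hgu (ε / (M + 1))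
        (by positivity))
      refine ⟨N, fun j hj => ?_⟩
      rw [dist_zero_right]
      unfold pairing
      rw [← integral_sub (hgu_int j) (integrable_mul_potential hK (hg j) (hg j) (hg0 j))]
      calc ‖∫ x, (u x * g j x - g j x * potential ν K (g j) x) ∂ν‖
          ≤ ∫ x, ε / (M + 1) * g j x ∂ν := by
            refine norm_integral_le_of_norm_le ((hg j).const_mul _)
              (Eventually.of_forall fun x => ?_)
            have := (hN j hj x).le
            rw [Real.dist_eq] at this
            rw [mul_comm (g j x), ← sub_mul, norm_mul, Real.norm_of_nonneg (hg0 j x)]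
            exact mul_le_mul_of_nonneg_right this (hg0 j x)
        _ = ε / (M + 1) * ∫ x, g j x ∂ν := integral_const_mul _ _
        _ ≤ ε / (M + 1) * M := by gcongr; exact hgM j
        _ < ε / (M + 1) * (M + 1) := by gcongr; linarith
        _ = ε := by field_simp
    simpa using hdiff.add hE
  refine ⟨f, hfint, hf0, hf1, ?_⟩
  calc pairing ν K f f ≤ ∫ x, u x * f x ∂ν := by
        refine integral_mono (integrable_mul_potential hK hfint hfint hf0)
          (integrable_continuous_mul hu hfint) fun x => ?_
        rw [mul_comm (u x)]
        exact mul_le_mul_of_nonneg_left (hpot_le x) (hf0 x)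
    _ ≤ m := (integral_le_of_tendsto_ae (fun j => hgu_int (ψ j))
        (fun j x => mul_nonneg (hu0 x) (hg0 _ x)) (hgf.mono fun x hx => hx.const_mul _)
        (fun j => le_rfl) (hlimE.comp hψ.tendsto_atTop)).2

end Existence

/-! ### The Euler-Lagrange equation. -/

section EulerLagrange

variable {X : Type*} [MetricSpace X] [CompactSpace X] [MeasurableSpace X] [BorelSpace X]
  {ν : Measure X} [IsFiniteMeasure ν] {K : X → X → ℝ} {f g w : X → ℝ} {p c : ℝ}

theorem integral_rpow_combination_ge (hp0 : 0 < p) (hp1 : p < 1)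
    (hf : Integrable f ν) (hf0 : ∀ x, 0 ≤ f x) (hg : Integrable g ν) (hg0 : ∀ x, 0 ≤ g x)
    {s : ℝ} (hs0 : 0 ≤ s) (hs1 : s ≤ 1) :
    (1 - s) * ∫ x, f x ^ p ∂ν + s * ∫ x, g x ^ p ∂ν ≤
      ∫ x, ((1 - s) * f x + s * g x) ^ p ∂ν := by
  have hF := integrable_rpow_of_nonneg hp0.le hp1.le hf hf0
  have hG := integrable_rpow_of_nonneg hp0.le hp1.le hg hg0
  have h0 : ∀ x, 0 ≤ (1 - s) * f x + s * g x := fun x =>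
    add_nonneg (mul_nonneg (by linarith) (hf0 x)) (mul_nonneg hs0 (hg0 x))
  rw [← integral_const_mul, ← integral_const_mul,
    ← integral_add (hF.const_mul _) (hG.const_mul _)]
  refine integral_mono ((hF.const_mul _).add (hG.const_mul _))
    (integrable_rpow_of_nonneg hp0.le hp1.le ((hf.const_mul _).add (hg.const_mul _)) h0) fun x => ?_
  exact (Real.concaveOn_rpow hp0.le hp1.le).2 (hf0 x) (hg0 x) (by linarith) hs0 (by ring)

/-- The profile `g` satisfying `m g ^ (p - 1) = potential f` cannot have larger power integral
than a minimizer `f`. -/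
theorem integral_rpow_le_one_of_minimizer (hK : Continuous (Function.uncurry K))
    (hsymm : ∀ x y, K x y = K y x) (hp0 : 0 < p) (hp1 : p < 1) {m : ℝ} (hm : 0 < m)
    (hmin : ∀ g, Integrable g ν → (∀ x, 0 ≤ g x) →
      m * (∫ x, g x ^ p ∂ν) ^ (2 / p) ≤ pairing ν K g g)
    (hf : Integrable f ν) (hf0 : ∀ x, 0 ≤ f x) (hg : Integrable g ν) (hg0 : ∀ x, 0 ≤ g x)
    (hf1 : ∫ x, f x ^ p ∂ν = 1) (hfE : pairing ν K f f ≤ m)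
    (hgf : pairing ν K g f = m * ∫ x, g x ^ p ∂ν) : ∫ x, g x ^ p ∂ν ≤ 1 := by
  set A := ∫ x, g x ^ p ∂ν with hA
  by_contra! hA1
  have h2p : 1 < 1 / p := by rw [lt_div_iff₀ hp0]; linarith
  set C := pairing ν K g g + m with hC
  have hB : 0 ≤ pairing ν K g g :=
    le_trans (mul_nonneg hm.le (Real.rpow_nonneg (by linarith) _)) (hmin g hg hg0)
  -- Compare energy and power integral at (1-s)f + sg. The constant terms cancel, and after division
  -- by s the first-order terms are bounded by sC; s → 0 then contradicts A > 1.
  have key : ∀ s ∈ Ioo (0 : ℝ) 1, (1 / p - 1) * (2 * m * (A - 1)) ≤ s * C := by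
    intro s hs
    have h1 := hmin (fun x => (1 - s) * f x + s * g x) ((hf.const_mul _).add (hg.const_mul _))
      fun x => add_nonneg (mul_nonneg (by linarith [hs.2]) (hf0 x)) (mul_nonneg hs.1.le (hg0 x))
    rw [pairing_combination hK hsymm hf hf0 hg hg0, hgf] at h1
    have h2 := integral_rpow_combination_ge hp0 hp1 hf hf0 hg hg0 hs.1.le hs.2.le
    rw [hf1, ← hA] at h2
    have h3 : 0 ≤ s * (A - 1) := mul_nonneg hs.1.le (by linarith)
    have h4 : 1 + 2 / p * (s * (A - 1)) ≤
        (∫ x, ((1 - s) * f x + s * g x) ^ p ∂ν) ^ (2 / p) :=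
      calc 1 + 2 / p * (s * (A - 1)) ≤ (1 + s * (A - 1)) ^ (2 / p) :=
            one_add_mul_self_le_rpow_one_add (by linarith) (by
              rw [le_div_iff₀ hp0]; linarith)
        _ ≤ _ := Real.rpow_le_rpow (by linarith) (by linarith) (by positivity)
    have h5 := mul_le_mul_of_nonneg_left h4 hm.le
    have h6 : (1 - s) ^ 2 * pairing ν K f f ≤ (1 - s) ^ 2 * m := by gcongr
    have h7 : s * ((1 / p - 1) * (2 * m * (A - 1))) ≤
        s * (s * (pairing ν K g g + m - 2 * m * A)) := by
      have e : 2 / p = 2 * (1 / p) := by ring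
      rw [e] at h5 h1
      nlinarith
    have h8 := le_of_mul_le_mul_left h7 hs.1
    refine h8.trans (mul_le_mul_of_nonneg_left ?_ hs.1.le)
    have : 0 ≤ 2 * m * A := by nlinarith
    linarith
  have hpos : 0 < (1 / p - 1) * (2 * m * (A - 1)) :=
    mul_pos (by linarith) (mul_pos (by linarith) (by linarith))
  have hlim : Tendsto (fun s : ℝ => s * C) (𝓝[>] 0) (𝓝 (0 * C)) :=
    ((continuous_id.mul continuous_const).tendsto 0).mono_left nhdsWithin_le_nhds
  have := ge_of_tendsto hlim (eventually_of_mem (Ioo_mem_nhdsGT one_pos) key)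
  linarith

/-- The minimizer is a continuous positive solution of the Euler-Lagrange equation. -/
theorem exists_continuous_minimizer (hK : Continuous (Function.uncurry K))
    (hsymm : ∀ x y, K x y = K y x) (hc : 0 < c)
    (hcK : ∀ x y, c ≤ K x y) (hν : ν ≠ 0) (hp0 : 0 < p) (hp1 : p < 1) :
    ∃ f : X → ℝ, Continuous f ∧ (∀ x, 0 < f x) ∧ (∀ x, f x ^ (p - 1) = potential ν K f x) ∧
      ∀ g, Integrable g ν → (∀ x, 0 ≤ g x) →
        pairing ν K f f * (∫ x, g x ^ p ∂ν) ^ (2 / p) ≤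
          pairing ν K g g * (∫ x, f x ^ p ∂ν) ^ (2 / p) := by
  obtain ⟨m, hm, hmin, f, hf, hf0, hf1, hfE⟩ :=
    exists_nonneg_minimizer hK hsymm hc hcK hν hp0 hp1
  obtain ⟨κ, hκ, hκle⟩ := exists_pos_le_integral hp0 hp1 ν
  set v := potential ν K f with hv
  have hvc : Continuous v := continuous_potential_of_nonneg hK hf hf0
  have hv0 : ∀ x, 0 < v x := fun x =>
    (mul_pos hc (hκ.trans_le (hκle f hf hf0 hf1))).trans_le
      (mul_integral_le_potential hK hcK hf hf0 x)
  -- This g solves m g^(p-1) = K f pointwise; the rest shows that it equals f almost everywhere.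
  obtain ⟨g, hg⟩ : ∃ g : X → ℝ, g = fun x => (v x / m) ^ (p - 1)⁻¹ := ⟨_, rfl⟩
  have hg0 : ∀ x, 0 < g x := fun x => by
    rw [hg]; exact Real.rpow_pos_of_pos (div_pos (hv0 x) hm) _
  have hgc : Continuous g := by
    rw [hg]
    exact (hvc.div_const m).rpow_const fun x => Or.inl (div_pos (hv0 x) hm).ne'
  have hgv : ∀ x, g x ^ (p - 1) = v x / m := fun x => by
    rw [hg]
    exact Real.rpow_inv_rpow (div_pos (hv0 x) hm).le (by linarith)
  have hvg : ∀ x, v x = m * g x ^ (p - 1) := fun x => by rw [hgv]; field_simp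
  have hgp : ∀ x, g x ^ (p - 1) * g x = g x ^ p := fun x => by
    rw [Real.rpow_sub_one (hg0 x).ne']; field_simp [(hg0 x).ne']
  have hgi : Integrable g ν := by
    simpa using integrable_continuous_mul hgc (integrable_const (1 : ℝ))
  have hgpi := integrable_rpow_of_nonneg hp0.le hp1.le hgi fun x => (hg0 x).le
  have hfpi := integrable_rpow_of_nonneg hp0.le hp1.le hf hf0
  have hgf : pairing ν K g f = m * ∫ x, g x ^ p ∂ν := by
    rw [← integral_const_mul]
    refine integral_congr_ae (Eventually.of_forall fun x => ?_)
    simp only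
    rw [← hv, hvg, ← hgp]; ring
  have hA1 := integral_rpow_le_one_of_minimizer hK hsymm hp0 hp1 hm hmin hf hf0 hgi
    (fun x => (hg0 x).le) hf1 hfE hgf
  have hEm : pairing ν K f f = m := by
    refine le_antisymm hfE ?_
    simpa [hf1] using hmin f hf hf0
  have hgfc : Continuous fun x => g x ^ (p - 1) :=
    hgc.rpow_const fun x => Or.inl (hg0 x).ne'
  have hgfi : Integrable (fun x => g x ^ (p - 1) * f x) ν := integrable_continuous_mul hgfc hf
  have hgf1 : ∫ x, g x ^ (p - 1) * f x ∂ν = 1 := by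
    have : m * ∫ x, g x ^ (p - 1) * f x ∂ν = m := by
      conv_rhs => rw [← hEm]
      rw [← integral_const_mul]
      refine integral_congr_ae (Eventually.of_forall fun x => ?_)
      simp only
      rw [← hv, hvg]; ring
    exact mul_left_cancel₀ hm.ne' (this.trans (mul_one m).symm)
  have hdefect0 : ∀ x, 0 ≤ g x ^ p + p * (g x ^ (p - 1) * f x - g x ^ p) - f x ^ p := fun x => by
    have := rpow_le_tangent hp0 hp1 (hf0 x) (hg0 x)
    rw [mul_sub, hgp] at this
    linarith
  have hdi : Integrable (fun x => g x ^ p + p * (g x ^ (p - 1) * f x - g x ^ p) - f x ^ p) ν :=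
    (hgpi.add ((hgfi.sub hgpi).const_mul p)).sub hfpi
  -- Because ∫ g^(p-1) f = E(f)/m = 1, the nonnegative tangent defect integrates to (1-p)(A-1),
  -- which forces A ≥ 1.
  have hdint : ∫ x, (g x ^ p + p * (g x ^ (p - 1) * f x - g x ^ p) - f x ^ p) ∂ν =
      (1 - p) * (∫ x, g x ^ p ∂ν - 1) := by
    have e1 := integral_sub (hgpi.add ((hgfi.sub hgpi).const_mul p)) hfpi
    have e2 := integral_add hgpi ((hgfi.sub hgpi).const_mul p)
    have e3 := integral_sub hgfi hgpi
    have e4 := integral_const_mul (μ := ν) p (fun x => g x ^ (p - 1) * f x - g x ^ p)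
    simp only [Pi.add_apply, Pi.sub_apply] at e1 e2 e3 e4
    rw [e1, e2, e4, e3, hgf1, hf1]; ring
  have hA : ∫ x, g x ^ p ∂ν = 1 := by
    refine le_antisymm hA1 ?_
    have : 0 ≤ ∫ x, (g x ^ p + p * (g x ^ (p - 1) * f x - g x ^ p) - f x ^ p) ∂ν :=
      integral_nonneg hdefect0
    rw [hdint] at this
    nlinarith
  have hfg : f =ᵐ[ν] g := by
    rw [hA, sub_self, mul_zero] at hdint
    have := (integral_eq_zero_iff_of_nonneg hdefect0 hdi).1 hdint
    filter_upwards [this] with x hx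
    by_contra hne
    have h1 := rpow_lt_tangent hp0 hp1 (hf0 x) (hg0 x) hne
    rw [mul_sub, hgp] at h1
    simp only [Pi.zero_apply] at hx
    linarith
  have hpg : potential ν K g = v := by
    funext x
    exact integral_congr_ae (hfg.mono fun y hy => by simp only [hy])
  have hEg : pairing ν K g g = m := by
    have e : pairing ν K g g = pairing ν K g f := by unfold pairing; rw [hpg]
    rw [e, hgf, hA, mul_one]
  -- Rescaling by t with t^(p-2) = m absorbs the multiplier m in the equation.
  set t := m ^ (p - 2)⁻¹ with ht
  have ht0 : 0 < t := Real.rpow_pos_of_pos hm _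
  have htm : t ^ (p - 1) = t * m := by
    have h1 : t ^ (p - 2) = m := Real.rpow_inv_rpow hm.le (by linarith)
    have h2 : t ^ (p - 1) = t ^ (p - 2 + 1) := by congr 1; ring
    rw [h2, Real.rpow_add_one ht0.ne', h1, mul_comm]
  refine ⟨fun x => t * g x, continuous_const.mul hgc, fun x => mul_pos ht0 (hg0 x), ?_, ?_⟩
  · intro x
    have e : potential ν K (fun x => t * g x) x = t * v x := by
      rw [← hpg]
      unfold potential
      rw [← integral_const_mul]
      congr 1 with y
      ring
    rw [e, Real.mul_rpow ht0.le (hg0 x).le, htm, hgv]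
    field_simp
  · intro h hh hh0
    have e1 : (∫ x, (t * g x) ^ p ∂ν) ^ (2 / p) = t ^ 2 := by
      simp_rw [Real.mul_rpow ht0.le (hg0 _).le]
      rw [integral_const_mul, hA, mul_one, ← Real.rpow_mul ht0.le]
      have : p * (2 / p) = (2 : ℕ) := by push_cast; field_simp
      rw [this, Real.rpow_natCast]
    rw [e1, pairing_smul, hEg, mul_comm _ (t ^ 2), mul_assoc]
    exact mul_le_mul_of_nonneg_left (hmin h hh hh0) (by positivity)

end EulerLagrange

/-! ### Regularity of potentials of homogeneous kernels. -/

section HomogeneousKernel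

universe v

variable {E : Type v} [NormedAddCommGroup E] [NormedSpace ℝ E] [FiniteDimensional ℝ E]
  {G : Type v} [NormedAddCommGroup G] [NormedSpace ℝ G] {s : ℝ} {φ : E → G}

/-- Kernels smooth away from the origin and positively homogeneous of degree `s`,
normalized to vanish at the origin. -/
structure IsHomogeneousKernel (s : ℝ) (φ : E → G) : Prop where
  map_zero : φ 0 = 0
  contDiffAt : ∀ x ≠ 0, ContDiffAt ℝ ∞ φ x
  map_smul : ∀ t : ℝ, 0 < t → ∀ x ≠ 0, φ (t • x) = t ^ s • φ x

/-- The derivative of a kernel, extended by zero to the origin. -/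
noncomputable def kernelDeriv (φ : E → G) (x : E) : E →L[ℝ] G :=
  open Classical in if x = 0 then 0 else fderiv ℝ φ x

theorem kernelDeriv_of_ne {x : E} (hx : x ≠ 0) : kernelDeriv φ x = fderiv ℝ φ x :=
  if_neg hx

namespace IsHomogeneousKernel

theorem hasFDerivAt (h : IsHomogeneousKernel s φ) {x : E} (hx : x ≠ 0) :
    HasFDerivAt φ (kernelDeriv φ x) x := by
  rw [kernelDeriv_of_ne hx]
  exact ((h.contDiffAt x hx).differentiableAt (by simp)).hasFDerivAt

/-- Differentiate φ(t x) = t^s φ(x) in x and divide by t. -/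
theorem kernelDeriv (h : IsHomogeneousKernel s φ) :
    IsHomogeneousKernel (s - 1) (kernelDeriv φ) where
  map_zero := if_pos rfl
  contDiffAt x hx := by
    refine ((h.contDiffAt x hx).fderiv_right (m := ∞) (by simp)).congr_of_eventuallyEq ?_
    filter_upwards [isOpen_ne.mem_nhds hx] with y hy
    exact kernelDeriv_of_ne hy
  map_smul t ht x hx := by
    have htx : t • x ≠ 0 := smul_ne_zero ht.ne' hx
    have h1 : HasFDerivAt (fun y => φ (t • y))
        ((_root_.kernelDeriv φ (t • x)).comp (t • ContinuousLinearMap.id ℝ E)) x :=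
      (h.hasFDerivAt htx).comp x ((hasFDerivAt_id x).const_smul t)
    have h2 : HasFDerivAt (fun y => φ (t • y)) (t ^ s • _root_.kernelDeriv φ x) x := by
      refine ((h.hasFDerivAt hx).const_smul (t ^ s)).congr_of_eventuallyEq ?_
      filter_upwards [isOpen_ne.mem_nhds hx] with y hy
      exact h.map_smul t ht y hy
    have h3 := h1.unique h2
    rw [ContinuousLinearMap.comp_smul, ContinuousLinearMap.comp_id] at h3
    rw [Real.rpow_sub_one ht.ne', div_eq_inv_mul, mul_smul, ← h3, smul_smul,
      inv_mul_cancel₀ ht.ne', one_smul]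

theorem exists_bound (h : IsHomogeneousKernel s φ) :
    ∃ C, 0 ≤ C ∧ ∀ x, ‖φ x‖ ≤ C * ‖x‖ ^ s := by
  obtain ⟨C, hC⟩ := (isCompact_sphere (0 : E) 1).exists_bound_of_continuousOn (f := φ)
    fun x hx => (h.contDiffAt x (ne_zero_of_mem_unit_sphere ⟨x, hx⟩)).continuousAt.continuousWithinAt
  refine ⟨max C 0, le_max_right _ _, fun x => ?_⟩
  rcases eq_or_ne x 0 with rfl | hx
  · rw [h.map_zero, norm_zero]; positivity
  · have hx0 : 0 < ‖x‖ := norm_pos_iff.2 hx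
    have hne : ‖x‖⁻¹ • x ≠ 0 := smul_ne_zero (inv_ne_zero hx0.ne') hx
    have e : φ x = ‖x‖ ^ s • φ (‖x‖⁻¹ • x) := by
      rw [← h.map_smul _ hx0 _ hne, smul_smul, mul_inv_cancel₀ hx0.ne', one_smul]
    have hb := hC (‖x‖⁻¹ • x) (by simp [norm_smul, inv_mul_cancel₀ hx0.ne'])
    rw [e, norm_smul, Real.norm_of_nonneg (by positivity), mul_comm]
    exact mul_le_mul_of_nonneg_right (hb.trans (le_max_left _ _)) (by positivity)

/-- If the segment from y to x avoids the origin, the mean value inequality applies, as the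
derivative has degree s - 1 ≥ 0. Otherwise ‖x‖ + ‖y‖ = ‖x - y‖ and the growth bound at each end
suffices. -/
theorem exists_lipschitz (h : IsHomogeneousKernel s φ) (hs : 1 ≤ s) (M : ℝ) :
    ∃ C, ∀ x y, ‖x‖ ≤ M → ‖y‖ ≤ M → ‖φ x - φ y‖ ≤ C * ‖x - y‖ := by
  obtain ⟨C₀, hC₀, hb₀⟩ := h.exists_bound
  obtain ⟨C₁, hC₁, hb₁⟩ := h.kernelDeriv.exists_bound
  refine ⟨max C₀ C₁ * M ^ (s - 1), fun x y hx hy => ?_⟩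
  have hM : 0 ≤ M := (norm_nonneg x).trans hx
  have hpow : ∀ z : E, ‖z‖ ≤ M → ‖z‖ ^ (s - 1) ≤ M ^ (s - 1) := fun z hz =>
    Real.rpow_le_rpow (norm_nonneg _) hz (by linarith)
  by_cases h0 : (0 : E) ∈ segment ℝ y x
  · have hlin : ∀ z : E, ‖z‖ ≤ M → ‖φ z‖ ≤ max C₀ C₁ * M ^ (s - 1) * ‖z‖ := by
      intro z hz
      rcases eq_or_ne z 0 with rfl | hz0
      · simp [h.map_zero]
      · calc ‖φ z‖ ≤ C₀ * ‖z‖ ^ s := hb₀ z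
          _ = C₀ * ‖z‖ ^ (s - 1) * ‖z‖ := by
            rw [Real.rpow_sub_one (norm_ne_zero_iff.2 hz0), mul_assoc,
              div_mul_cancel₀ _ (norm_ne_zero_iff.2 hz0)]
          _ ≤ _ := by gcongr; exact le_max_left _ _
    have hd := dist_add_dist_of_mem_segment h0
    rw [dist_zero_right, dist_zero_left, dist_comm, dist_eq_norm] at hd
    rw [← hd, mul_add, add_comm]
    exact (norm_sub_le _ _).trans (add_le_add (hlin x hx) (hlin y hy))
  · refine Convex.norm_image_sub_le_of_norm_hasFDerivWithin_le
      (f' := _root_.kernelDeriv φ) (fun z hz => ?_) (fun z hz => ?_) (convex_segment y x)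
      (left_mem_segment ℝ y x) (right_mem_segment ℝ y x)
    · exact (h.hasFDerivAt fun hz0 => h0 (hz0 ▸ hz)).hasFDerivWithinAt
    · have hzM : ‖z‖ ≤ M := by
        have := (convex_closedBall (0 : E) M).segment_subset
          (mem_closedBall_zero_iff.2 hy) (mem_closedBall_zero_iff.2 hx) hz
        exact mem_closedBall_zero_iff.1 this
      refine (hb₁ z).trans ?_
      gcongr
      exact le_max_right _ _

variable {Ω : Type*} [MeasurableSpace Ω] {μ : Measure Ω} {ι : Ω → E} {g : Ω → ℝ}
  [MeasurableSpace E] [BorelSpace E]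

theorem aestronglyMeasurable (h : IsHomogeneousKernel s φ) (hι : Measurable ι)
    (hg : Integrable g μ) (x : E) :
    AEStronglyMeasurable (fun a => g a • φ (x - ι a)) μ := by
  have hφ : StronglyMeasurable φ := by
    refine ContinuousOn.stronglyMeasurable_of_countable_compl (s := {0}ᶜ)
      (fun y hy => (h.contDiffAt y hy).continuousAt.continuousWithinAt) ?_
    simp
  exact hg.1.smul (hφ.comp_measurable (measurable_const.sub hι)).aestronglyMeasurable

theorem norm_sub_le_of_mem_ball {x x₀ z : E} (hx : x ∈ Metric.ball x₀ 1) (hz : ‖z‖ ≤ 1) :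
    ‖x - z‖ ≤ ‖x₀‖ + 2 := by
  have h1 : ‖x - x₀‖ < 1 := by rwa [← dist_eq_norm]
  calc ‖x - z‖ = ‖(x - x₀) + x₀ - z‖ := by rw [sub_add_cancel]
    _ ≤ ‖x - x₀‖ + ‖x₀‖ + ‖z‖ := (norm_sub_le _ _).trans (by gcongr; exact norm_add_le _ _)
    _ ≤ _ := by linarith

theorem norm_smul_le (h : IsHomogeneousKernel s φ) (hs : 0 ≤ s) (hι1 : ∀ a, ‖ι a‖ ≤ 1) (x₀ : E) :
    ∃ C, ∀ x ∈ Metric.ball x₀ 1, ∀ a, ‖g a • φ (x - ι a)‖ ≤ ‖g a‖ * C := by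
  obtain ⟨C, hC, hb⟩ := h.exists_bound
  refine ⟨C * (‖x₀‖ + 2) ^ s, fun x hx a => ?_⟩
  rw [norm_smul]
  refine mul_le_mul_of_nonneg_left ((hb _).trans ?_) (norm_nonneg _)
  gcongr
  exact norm_sub_le_of_mem_ball hx (hι1 a)

theorem integrable (h : IsHomogeneousKernel s φ) (hs : 0 ≤ s) (hι : Measurable ι)
    (hι1 : ∀ a, ‖ι a‖ ≤ 1) (hg : Integrable g μ) (x : E) :
    Integrable (fun a => g a • φ (x - ι a)) μ := by
  obtain ⟨C, hC⟩ := h.norm_smul_le (g := g) hs hι1 x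
  exact (hg.norm.mul_const C).mono' (h.aestronglyMeasurable hι hg x)
    (Eventually.of_forall fun a => hC x (Metric.mem_ball_self one_pos) a)

theorem continuous_integral (h : IsHomogeneousKernel s φ) (hs : 0 ≤ s) (hι : Measurable ι)
    (hι1 : ∀ a, ‖ι a‖ ≤ 1) (hμ : ∀ x, ∀ᵐ a ∂μ, ι a ≠ x) (hg : Integrable g μ) :
    Continuous fun x => ∫ a, g a • φ (x - ι a) ∂μ := by
  rw [continuous_iff_continuousAt]
  intro x₀
  obtain ⟨C, hC⟩ := h.norm_smul_le (g := g) hs hι1 x₀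
  refine continuousAt_of_dominated (Eventually.of_forall fun x => h.aestronglyMeasurable hι hg x)
    (eventually_of_mem (Metric.ball_mem_nhds x₀ one_pos) fun x hx => Eventually.of_forall (hC x hx))
    (hg.norm.mul_const C) ?_
  filter_upwards [hμ x₀] with a ha
  have h1 := (h.contDiffAt (x₀ - ι a) (sub_ne_zero.2 ha.symm)).continuousAt
  have h2 : ContinuousAt (fun x => x - ι a) x₀ := continuousAt_id.sub continuousAt_const
  exact continuousAt_const.smul (ContinuousAt.comp (f := fun x => x - ι a) h1 h2)

/-- The kernel need not be differentiable at the origin. The local Lipschitz bound serves as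
domination, and differentiability of the integrand is needed only for almost every a. -/
theorem hasFDerivAt_integral (h : IsHomogeneousKernel s φ) (hs : 1 ≤ s) (hι : Measurable ι)
    (hι1 : ∀ a, ‖ι a‖ ≤ 1) (hμ : ∀ x, ∀ᵐ a ∂μ, ι a ≠ x) (hg : Integrable g μ) (x₀ : E) :
    HasFDerivAt (fun x => ∫ a, g a • φ (x - ι a) ∂μ)
      (∫ a, g a • _root_.kernelDeriv φ (x₀ - ι a) ∂μ) x₀ := by
  obtain ⟨C, hC⟩ := h.exists_lipschitz hs (‖x₀‖ + 2)
  refine (hasFDerivAt_integral_of_dominated_loc_of_lip' (bound := fun a => ‖g a‖ * C)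
    (Metric.ball_mem_nhds x₀ one_pos) (fun x _ => h.aestronglyMeasurable hι hg x)
    (h.integrable (by linarith) hι hι1 hg x₀) (h.kernelDeriv.aestronglyMeasurable hι hg x₀)
    (Eventually.of_forall fun a x hx => ?_) (hg.norm.mul_const C) ?_).2
  · rw [← smul_sub, norm_smul, mul_assoc]
    refine mul_le_mul_of_nonneg_left ?_ (norm_nonneg _)
    have := hC (x - ι a) (x₀ - ι a) (norm_sub_le_of_mem_ball hx (hι1 a))
      (norm_sub_le_of_mem_ball (Metric.mem_ball_self one_pos) (hι1 a))
    simpa using this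
  · filter_upwards [hμ x₀] with a ha
    have h1 := h.hasFDerivAt (sub_ne_zero.2 ha.symm)
    exact (h1.comp x₀ ((hasFDerivAt_id x₀).sub_const (ι a))).const_smul (g a)

end IsHomogeneousKernel

/-- Convolving a kernel of degree `s ≥ k` with a diffuse bounded measure gives a `C^k` function. -/
theorem IsHomogeneousKernel.contDiff_integral {Ω : Type*} [MeasurableSpace Ω] {μ : Measure Ω}
    {ι : Ω → E} {g : Ω → ℝ} [MeasurableSpace E] [BorelSpace E] (hι : Measurable ι)
    (hι1 : ∀ a, ‖ι a‖ ≤ 1) (hμ : ∀ x, ∀ᵐ a ∂μ, ι a ≠ x) (hg : Integrable g μ) (k : ℕ) :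
    ∀ {G : Type v} [NormedAddCommGroup G] [NormedSpace ℝ G] {s : ℝ} {φ : E → G},
      IsHomogeneousKernel s φ → (k : ℝ) ≤ s →
      ContDiff ℝ k fun x => ∫ a, g a • φ (x - ι a) ∂μ := by
  -- The target space G varies in the induction, since a derivative takes values in E →L[ℝ] G;
  -- sharing one universe for E and G keeps that space admissible.
  induction k with
  | zero =>
    intro G _ _ s φ h hs
    rw [Nat.cast_zero, contDiff_zero]
    exact h.continuous_integral (by simpa using hs) hι hι1 hμ hg
  | succ k ih =>
    intro G _ _ s φ h hs
    push_cast at hs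
    rw [Nat.cast_succ, contDiff_succ_iff_hasFDerivAt]
    exact ⟨_, ih h.kernelDeriv (by linarith), fun x =>
      h.hasFDerivAt_integral (by have := k.cast_nonneg (α := ℝ); linarith) hι hι1 hμ hg x⟩

end HomogeneousKernel

/-! ### The sphere: surface measure, even Riesz kernel, translation of the functional. -/

section Sphere

variable {n : ℕ} {α : ℝ} {R f g : UnitSphere n → ℝ}

instance (n : ℕ) : IsFiniteMeasure (surfaceMeasure n) := by
  unfold surfaceMeasure; infer_instance

theorem surfaceMeasure_ne_zero (n : ℕ) : surfaceMeasure n ≠ 0 :=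
  Measure.toSphere_ne_zero _

theorem measurePreserving_neg_sphere (n : ℕ) :
    MeasurePreserving (fun ξ : UnitSphere n => -ξ) (surfaceMeasure n) (surfaceMeasure n) := by
  have hm : Measurable fun ξ : UnitSphere n => -ξ := continuous_neg.measurable
  refine ⟨hm, Measure.ext fun s hs => ?_⟩
  rw [Measure.map_apply hm hs, surfaceMeasure, Measure.toSphere_apply' _ (hm hs),
    Measure.toSphere_apply' _ hs]
  have e : ((↑) '' ((fun ξ : UnitSphere n => -ξ) ⁻¹' s) : Set (EuclideanSpace ℝ (Fin (n + 1)))) =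
      -((↑) '' s) := by
    ext x
    simp only [mem_image, mem_preimage, Set.mem_neg]
    constructor
    · rintro ⟨y, hy, rfl⟩
      exact ⟨-y, hy, rfl⟩
    · rintro ⟨y, hy, hx⟩
      exact ⟨-y, by rwa [neg_neg], by rw [coe_neg_sphere, hx, neg_neg]⟩
  rw [e, Set.smul_neg, Measure.measure_neg]

open scoped Pointwise in
-- The cone over a point lies in a line, a proper subspace of ℝ^{n+1} because n ≥ 1.
theorem surfaceMeasure_singleton (hn : 1 ≤ n) (ξ : UnitSphere n) :
    surfaceMeasure n {ξ} = 0 := by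
  rw [surfaceMeasure, Measure.toSphere_apply' _ (measurableSet_singleton ξ)]
  set x : EuclideanSpace ℝ (Fin (n + 1)) := ξ.1 with hx
  have h0 : volume (Submodule.span ℝ {x} : Set (EuclideanSpace ℝ (Fin (n + 1)))) = 0 := by
    refine Measure.addHaar_submodule _ _ fun h => ?_
    have h1 := finrank_span_singleton (K := ℝ) (ne_zero_of_mem_unit_sphere ξ)
    rw [h, finrank_top, finrank_euclideanSpace_fin] at h1
    omega
  have h1 : volume (Ioo (0 : ℝ) 1 • ((↑) '' ({ξ} : Set (UnitSphere n)) :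
      Set (EuclideanSpace ℝ (Fin (n + 1))))) = 0 := by
    refine measure_mono_null ?_ h0
    rw [image_singleton]
    rintro _ ⟨t, -, _, rfl, rfl⟩
    exact Submodule.smul_mem _ t (Submodule.mem_span_singleton_self x)
  rw [h1, mul_zero]

theorem ae_coe_ne (hn : 1 ≤ n) (x : EuclideanSpace ℝ (Fin (n + 1))) :
    ∀ᵐ ξ : UnitSphere n ∂(surfaceMeasure n), (ξ : EuclideanSpace ℝ (Fin (n + 1))) ≠ x := by
  by_cases hx : x ∈ Metric.sphere (0 : EuclideanSpace ℝ (Fin (n + 1))) 1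
  · have h := measure_eq_zero_iff_ae_notMem.1 (surfaceMeasure_singleton hn ⟨x, hx⟩)
    filter_upwards [h] with ξ hξ h'
    exact hξ (Subtype.ext h')
  · exact Eventually.of_forall fun ξ h => hx (h ▸ ξ.2)

theorem isHomogeneousKernel_norm_rpow (n : ℕ) {β : ℝ} (hβ : 0 < β) :
    IsHomogeneousKernel β fun x : EuclideanSpace ℝ (Fin (n + 1)) => ‖x‖ ^ β where
  map_zero := by simp [Real.zero_rpow hβ.ne']
  contDiffAt x hx := (contDiffAt_norm ℝ hx).rpow_const_of_ne (norm_ne_zero_iff.2 hx)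
  map_smul t ht x _ := by
    rw [norm_smul, Real.norm_of_nonneg ht.le, Real.mul_rpow ht.le (norm_nonneg x), smul_eq_mul]

/-- The surface measure weighted by `R`. -/
noncomputable def weightedMeasure (R : UnitSphere n → ℝ) : Measure (UnitSphere n) :=
  (surfaceMeasure n).withDensity fun ξ => ENNReal.ofReal (R ξ)

/-- The kernel `|ξ - η| ^ (α - n)`. -/
noncomputable def rieszKernel (α : ℝ) (ξ η : UnitSphere n) : ℝ :=
  chordalDist ξ η ^ (α - (n : ℝ))

/-- The average of the Riesz kernel over antipodal pairs. -/
noncomputable def evenRieszKernel (α : ℝ) (ξ η : UnitSphere n) : ℝ :=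
  (rieszKernel α ξ η + rieszKernel α ξ (-η)) / 2

theorem chordalDist_comm (ξ η : UnitSphere n) : chordalDist ξ η = chordalDist η ξ :=
  norm_sub_rev _ _

theorem chordalDist_neg_neg (ξ η : UnitSphere n) : chordalDist (-ξ) (-η) = chordalDist ξ η := by
  unfold chordalDist
  rw [coe_neg_sphere, coe_neg_sphere, ← neg_sub', norm_neg]

theorem chordalDist_neg_left (ξ η : UnitSphere n) : chordalDist (-ξ) η = chordalDist ξ (-η) := by
  rw [← chordalDist_neg_neg, neg_neg]

theorem continuous_rieszKernel (hα : (n : ℝ) < α) :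
    Continuous (Function.uncurry (rieszKernel (n := n) α)) := by
  have h : Continuous fun z : UnitSphere n × UnitSphere n => chordalDist z.1 z.2 := by
    unfold chordalDist; fun_prop
  exact h.rpow_const fun _ => Or.inr (by linarith)

theorem continuous_evenRieszKernel (hα : (n : ℝ) < α) :
    Continuous (Function.uncurry (evenRieszKernel (n := n) α)) := by
  have h := continuous_rieszKernel hα
  have h2 : Continuous fun z : UnitSphere n × UnitSphere n => rieszKernel α z.1 (-z.2) :=
    h.comp (f := fun z : UnitSphere n × UnitSphere n => (z.1, -z.2)) (by fun_prop)
  have h3 : Continuous fun z : UnitSphere n × UnitSphere n => rieszKernel α z.1 z.2 := h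
  exact (h3.add h2).div_const 2

theorem evenRieszKernel_comm (ξ η : UnitSphere n) :
    evenRieszKernel α ξ η = evenRieszKernel α η ξ := by
  unfold evenRieszKernel rieszKernel
  rw [chordalDist_comm ξ η, chordalDist_comm ξ (-η), chordalDist_neg_left]

theorem evenRieszKernel_neg_left (ξ η : UnitSphere n) :
    evenRieszKernel α (-ξ) η = evenRieszKernel α ξ η := by
  unfold evenRieszKernel rieszKernel
  rw [chordalDist_neg_neg, chordalDist_neg_left, add_comm]

/-- The distances from ξ to η and to -η add up to at least 2, so one of the two kernel values is at
least 1. -/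
theorem half_le_evenRieszKernel (hα : (n : ℝ) < α) (ξ η : UnitSphere n) :
    1 / 2 ≤ evenRieszKernel α ξ η := by
  have hβ : 0 < α - n := by linarith
  have hsum : 2 ≤ chordalDist ξ η + chordalDist ξ (-η) := by
    unfold chordalDist
    rw [coe_neg_sphere, sub_neg_eq_add]
    have h1 : ‖(2 : ℝ) • (ξ : EuclideanSpace ℝ (Fin (n + 1)))‖ = 2 := by
      rw [norm_smul, norm_eq_of_mem_sphere]; norm_num
    have h2 : (2 : ℝ) • (ξ : EuclideanSpace ℝ (Fin (n + 1))) =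
        ((ξ : EuclideanSpace ℝ (Fin (n + 1))) - η) + (ξ + η) := by rw [two_smul]; abel
    rw [← h1, h2]
    exact norm_add_le _ _
  have h0 : ∀ η : UnitSphere n, 0 ≤ rieszKernel α ξ η := fun η =>
    Real.rpow_nonneg (norm_nonneg _) _
  have h1 : ∀ η : UnitSphere n, 1 ≤ chordalDist ξ η → 1 ≤ rieszKernel α ξ η := fun η h =>
    Real.one_le_rpow h hβ.le
  unfold evenRieszKernel
  rcases le_total 1 (chordalDist ξ η) with h | h
  · linarith [h1 η h, h0 (-η)]
  · linarith [h1 (-η) (by linarith), h0 η]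

theorem ae_weightedMeasure {P : UnitSphere n → Prop} (h : ∀ᵐ ξ ∂(surfaceMeasure n), P ξ) :
    ∀ᵐ ξ ∂(weightedMeasure R), P ξ :=
  (withDensity_absolutelyContinuous _ _).ae_le h

theorem integral_weightedMeasure (hRc : Continuous R) (hR : ∀ ξ, 0 < R ξ) (f : UnitSphere n → ℝ) :
    ∫ ξ, f ξ ∂(weightedMeasure R) = ∫ ξ, R ξ * f ξ ∂(surfaceMeasure n) := by
  rw [weightedMeasure, integral_withDensity_eq_integral_toReal_smul
    hRc.measurable.ennreal_ofReal (Eventually.of_forall fun _ => ENNReal.ofReal_lt_top)]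
  simp_rw [ENNReal.toReal_ofReal (hR _).le, smul_eq_mul]

theorem integrable_weightedMeasure (hRc : Continuous R) (hR : ∀ ξ, 0 < R ξ)
    (hf : Integrable f (surfaceMeasure n)) : Integrable f (weightedMeasure R) := by
  rw [weightedMeasure, integrable_withDensity_iff_integrable_smul'
    hRc.measurable.ennreal_ofReal (Eventually.of_forall fun _ => ENNReal.ofReal_lt_top)]
  simp_rw [ENNReal.toReal_ofReal (hR _).le, smul_eq_mul]
  exact integrable_continuous_mul hRc hf

theorem isFiniteMeasure_weightedMeasure (hRc : Continuous R) :
    IsFiniteMeasure (weightedMeasure R) := by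
  have h : Integrable R (surfaceMeasure n) := by
    simpa using integrable_continuous_mul hRc (integrable_const (μ := surfaceMeasure n) (1 : ℝ))
  exact isFiniteMeasure_withDensity_ofReal h.2

theorem weightedMeasure_ne_zero (hRc : Continuous R) (hR : ∀ ξ, 0 < R ξ) :
    weightedMeasure R ≠ 0 := by
  intro h
  rw [weightedMeasure, withDensity_eq_zero_iff hRc.measurable.ennreal_ofReal.aemeasurable] at h
  have := ae_neBot.2 (surfaceMeasure_ne_zero n)
  obtain ⟨ξ, hξ⟩ := h.exists
  exact (ENNReal.ofReal_pos.2 (hR ξ)).ne' hξ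

theorem integral_neg_weightedMeasure (hRc : Continuous R) (hR : ∀ ξ, 0 < R ξ)
    (hRs : AntipodallySymmetric R) (f : UnitSphere n → ℝ) :
    ∫ ξ, f (-ξ) ∂(weightedMeasure R) = ∫ ξ, f ξ ∂(weightedMeasure R) := by
  rw [integral_weightedMeasure hRc hR, integral_weightedMeasure hRc hR]
  have h := (measurePreserving_neg_sphere n).integral_comp
    (Homeomorph.neg (UnitSphere n)).measurableEmbedding (fun ξ => R ξ * f ξ)
  rw [← h]
  simp_rw [hRs _]

/-- On even functions the Riesz kernel may be replaced by its even part. -/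
theorem potential_evenRieszKernel (hα : (n : ℝ) < α) (hRc : Continuous R) (hR : ∀ ξ, 0 < R ξ)
    (hRs : AntipodallySymmetric R) (hf : Integrable f (surfaceMeasure n))
    (hfs : ∀ᵐ ξ ∂(surfaceMeasure n), f (-ξ) = f ξ) :
    potential (weightedMeasure R) (evenRieszKernel α) f =
      potential (weightedMeasure R) (rieszKernel α) f := by
  funext ξ
  have := isFiniteMeasure_weightedMeasure hRc
  have hfs' : ∀ᵐ η ∂(weightedMeasure R), f (-η) = f η :=
    ae_weightedMeasure hfs
  have hfi := integrable_weightedMeasure hRc hR hf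
  have hc : Continuous fun η => rieszKernel α ξ η :=
    (continuous_rieszKernel hα).comp (f := fun η : UnitSphere n => (ξ, η)) (by fun_prop)
  have h1 := integrable_continuous_mul hc hfi
  have hc' : Continuous fun η => rieszKernel α ξ (-η) :=
    hc.comp (f := fun η : UnitSphere n => -η) continuous_neg
  have h2 := integrable_continuous_mul hc' hfi
  -- Substitute η ↦ -η: the weighted measure is invariant because R is even.
  have e : ∫ η, rieszKernel α ξ (-η) * f η ∂(weightedMeasure R) =
      ∫ η, rieszKernel α ξ η * f η ∂(weightedMeasure R) := by
    refine Eq.trans (integral_congr_ae (hfs'.mono fun η hη => ?_))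
      (integral_neg_weightedMeasure hRc hR hRs fun η => rieszKernel α ξ η * f η)
    simp only [hη]
  have e2 : ∀ η, evenRieszKernel α ξ η * f η =
      1 / 2 * (rieszKernel α ξ η * f η + rieszKernel α ξ (-η) * f η) := fun η => by
    unfold evenRieszKernel; ring
  unfold potential
  simp_rw [e2]
  rw [integral_const_mul, integral_add h1 h2, e]
  ring

theorem energyH_eq_pairing (hα : (n : ℝ) < α) (hRc : Continuous R) (hR : ∀ ξ, 0 < R ξ)
    (hRs : AntipodallySymmetric R) (hf : Integrable f (surfaceMeasure n))
    (hfs : ∀ᵐ ξ ∂(surfaceMeasure n), f (-ξ) = f ξ) :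
    energyH α R f = pairing (weightedMeasure R) (evenRieszKernel α) f f := by
  unfold pairing
  rw [potential_evenRieszKernel hα hRc hR hRs hf hfs, integral_weightedMeasure hRc hR]
  unfold energyH potential
  congr 1 with η
  rw [integral_weightedMeasure hRc hR, ← mul_assoc, ← integral_const_mul]
  congr 1 with ξ
  rw [rieszKernel, chordalDist_comm]
  ring

theorem weightedNorm_sq (hRc : Continuous R) (hR : ∀ ξ, 0 < R ξ)
    (hf : ∀ᵐ ξ ∂(surfaceMeasure n), 0 < f ξ) :
    weightedNorm α R f ^ 2 =
      (∫ ξ, f ξ ^ (2 * (n : ℝ) / ((n : ℝ) + α)) ∂(weightedMeasure R)) ^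
        (2 / (2 * (n : ℝ) / ((n : ℝ) + α))) := by
  have hint : ∫ ξ, f ξ ^ (2 * (n : ℝ) / ((n : ℝ) + α)) * R ξ ∂(surfaceMeasure n) =
      ∫ ξ, f ξ ^ (2 * (n : ℝ) / ((n : ℝ) + α)) ∂(weightedMeasure R) := by
    rw [integral_weightedMeasure hRc hR]
    simp_rw [mul_comm]
  have h0 : 0 ≤ ∫ ξ, f ξ ^ (2 * (n : ℝ) / ((n : ℝ) + α)) ∂(weightedMeasure R) :=
    integral_nonneg_of_ae ((ae_weightedMeasure hf).mono
      fun ξ hξ => Real.rpow_nonneg hξ.le _)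
  rw [weightedNorm, hint, ← Real.rpow_natCast, ← Real.rpow_mul h0]
  congr 1
  rw [div_div_eq_mul_div, div_mul_eq_mul_div]
  push_cast
  ring

theorem quotientJ_le_of_pairing_le (hα : (n : ℝ) < α) (hn : 1 ≤ n) (hRc : Continuous R)
    (hR : ∀ ξ, 0 < R ξ)
    (hRs : AntipodallySymmetric R) (hf : f ∈ admissibleClass n) (hg : g ∈ admissibleClass n)
    (hle : pairing (weightedMeasure R) (evenRieszKernel α) f f *
        (∫ x, g x ^ (2 * (n : ℝ) / ((n : ℝ) + α)) ∂(weightedMeasure R)) ^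
          (2 / (2 * (n : ℝ) / ((n : ℝ) + α))) ≤
      pairing (weightedMeasure R) (evenRieszKernel α) g g *
        (∫ x, f x ^ (2 * (n : ℝ) / ((n : ℝ) + α)) ∂(weightedMeasure R)) ^
          (2 / (2 * (n : ℝ) / ((n : ℝ) + α)))) :
    quotientJ α R f ≤ quotientJ α R g := by
  have := isFiniteMeasure_weightedMeasure hRc
  have := ae_neBot.2 (weightedMeasure_ne_zero hRc hR)
  have hn0 : (0 : ℝ) < n := by exact_mod_cast hn
  have hp0 : 0 < 2 * (n : ℝ) / ((n : ℝ) + α) := by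
    have : 0 < (n : ℝ) + α := by linarith
    positivity
  have hp1 : 2 * (n : ℝ) / ((n : ℝ) + α) < 1 := by
    rw [div_lt_one (by linarith)]; linarith
  -- Positivity almost everywhere and a nonzero measure make the denominators positive, so the
  -- cross-multiplied inequality can be divided.
  have hpos : ∀ h ∈ admissibleClass n,
      0 < (∫ x, h x ^ (2 * (n : ℝ) / ((n : ℝ) + α)) ∂(weightedMeasure R)) ^
          (2 / (2 * (n : ℝ) / ((n : ℝ) + α))) := by
    rintro h ⟨hi, h0, -⟩
    have h0' : ∀ᵐ ξ ∂(weightedMeasure R), 0 < h ξ :=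
      ae_weightedMeasure h0
    have hnn : 0 ≤ᵐ[weightedMeasure R] fun x => h x ^ (2 * (n : ℝ) / ((n : ℝ) + α)) :=
      h0'.mono fun ξ hξ => Real.rpow_nonneg hξ.le _
    have hint : Integrable (fun x => h x ^ (2 * (n : ℝ) / ((n : ℝ) + α))) (weightedMeasure R) := by
      refine (integrable_rpow_of_nonneg hp0.le hp1.le
        (integrable_weightedMeasure hRc hR hi).pos_part fun x => le_max_right _ _).congr ?_
      filter_upwards [h0'] with ξ hξ
      rw [max_eq_left hξ.le]
    refine Real.rpow_pos_of_pos ((integral_nonneg_of_ae hnn).lt_of_ne fun heq => ?_) _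
    obtain ⟨ξ, h1, h2⟩ :=
      (((integral_eq_zero_iff_of_nonneg_ae hnn hint).1 heq.symm).and h0').exists
    exact (Real.rpow_pos_of_pos h2 _).ne' h1
  unfold quotientJ
  rw [energyH_eq_pairing hα hRc hR hRs hf.1 hf.2.2, energyH_eq_pairing hα hRc hR hRs hg.1 hg.2.2,
    weightedNorm_sq hRc hR hf.2.1, weightedNorm_sq hRc hR hg.2.1,
    div_le_div_iff₀ (hpos f hf) (hpos g hg)]
  exact hle

/-- Smoothness is proved on all of ℝ^{n+1}, for restriction to the sphere; the order is admissible
because ⌊α⌋ - n ≤ α - n. -/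
theorem contDiff_weighted_potential (hn : 1 ≤ n) (hα : (n : ℝ) < α)
    (hf : Integrable f (surfaceMeasure n)) :
    ContDiff ℝ (⌊α⌋₊ - n : ℕ) fun x : EuclideanSpace ℝ (Fin (n + 1)) =>
      ∫ η : UnitSphere n, f η • ‖x - η‖ ^ (α - (n : ℝ)) ∂(surfaceMeasure n) := by
  refine IsHomogeneousKernel.contDiff_integral measurable_subtype_coe
    (fun η => (norm_eq_of_mem_sphere η).le) (ae_coe_ne hn) hf _
    (isHomogeneousKernel_norm_rpow n (by linarith)) ?_
  have h1 : n ≤ ⌊α⌋₊ := Nat.le_floor hα.le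
  rw [Nat.cast_sub h1]
  have := Nat.floor_le (n.cast_nonneg.trans hα.le)
  linarith

end Sphere

/-! ### Assembly of the main theorem. -/

theorem theorem1p1 (n : ℕ) (hn : 1 ≤ n) (α : ℝ) (hα : (n : ℝ) < α)
    (R : UnitSphere n → ℝ) (hRcont : Continuous R) (hRpos : ∀ ξ, 0 < R ξ)
    (hRsymm : AntipodallySymmetric R) :
    ∃ u f : UnitSphere n → ℝ,
      -- the solution of the integral equation
      (IsPositiveSolution α R u ∧ AntipodallySymmetric u ∧
        ContMDiff (𝓡 n) 𝓘(ℝ, ℝ) ((⌊α⌋₊ - n : ℕ) : ℕ∞ω) u) ∧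
      -- the minimizer of the quotient functional
      ((∀ ξ, 0 < f ξ) ∧ AntipodallySymmetric f ∧
        ContMDiff (𝓡 n) 𝓘(ℝ, ℝ) ((⌊α⌋₊ - n : ℕ) : ℕ∞ω) f ∧
        f ∈ admissibleClass n ∧ IsMinOn (quotientJ α R) (admissibleClass n) f) ∧
      -- the relation between the two
      (∀ ξ, f ξ = u ξ ^ (((n : ℝ) + α) / ((n : ℝ) - α))) := by
  have := isFiniteMeasure_weightedMeasure hRcont
  have hn0 : (0 : ℝ) < n := by exact_mod_cast hn
  obtain ⟨p, hp⟩ : ∃ p, p = 2 * (n : ℝ) / ((n : ℝ) + α) := ⟨_, rfl⟩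
  have hp0 : 0 < p := by
    have : 0 < (n : ℝ) + α := by linarith
    rw [hp]; positivity
  have hp1 : p < 1 := by rw [hp, div_lt_one (by linarith)]; linarith
  have hq : (p - 1)⁻¹ = ((n : ℝ) + α) / ((n : ℝ) - α) := by
    have h1 : (n : ℝ) + α ≠ 0 := by linarith
    have h2 : (n : ℝ) - α ≠ 0 := by linarith
    have h3 : p - 1 = ((n : ℝ) - α) / ((n : ℝ) + α) := by rw [hp]; field_simp; ring
    rw [h3, inv_div]
  obtain ⟨f, hfc, hf0, hfeq, hfmin⟩ := exists_continuous_minimizer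
    (continuous_evenRieszKernel hα) evenRieszKernel_comm one_half_pos
    (half_le_evenRieszKernel hα) (weightedMeasure_ne_zero hRcont hRpos) hp0 hp1
  have hfi : Integrable f (surfaceMeasure n) := by
    simpa using integrable_continuous_mul hfc (integrable_const (1 : ℝ))
  obtain ⟨u, hu⟩ : ∃ u : UnitSphere n → ℝ, u = fun ξ => f ξ ^ (p - 1) := ⟨_, rfl⟩
  have hu0 : ∀ ξ, 0 < u ξ := fun ξ => by rw [hu]; exact Real.rpow_pos_of_pos (hf0 ξ) _
  have hfu : ∀ ξ, f ξ = u ξ ^ (((n : ℝ) + α) / ((n : ℝ) - α)) := fun ξ => by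
    rw [← hq, hu]
    exact (Real.rpow_rpow_inv (hf0 ξ).le (by linarith)).symm
  -- Evenness comes from the equation u = K f, since K is even in its first variable.
  have hus : AntipodallySymmetric u := fun ξ => by
    rw [hu]; simp only
    rw [hfeq, hfeq]
    unfold potential
    simp_rw [evenRieszKernel_neg_left]
  have hfs : AntipodallySymmetric f := fun ξ => by rw [hfu, hfu, hus]
  have hpot : ∀ ξ, u ξ = ∫ η, R η * f η * chordalDist ξ η ^ (α - (n : ℝ)) ∂(surfaceMeasure n) := by
    intro ξ
    rw [hu]; simp only
    rw [hfeq, potential_evenRieszKernel hα hRcont hRpos hRsymm hfi (Eventually.of_forall hfs),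
      potential, integral_weightedMeasure hRcont hRpos]
    congr 1 with η
    rw [rieszKernel]; ring
  have hF := contDiff_weighted_potential hn hα (integrable_continuous_mul hRcont hfi)
  have huF : ∀ ξ, u ξ = ∫ η : UnitSphere n, (R η * f η) •
      ‖(ξ : EuclideanSpace ℝ (Fin (n + 1))) - η‖ ^ (α - (n : ℝ)) ∂(surfaceMeasure n) := hpot
  have huC : ContMDiff (𝓡 n) 𝓘(ℝ, ℝ) ((⌊α⌋₊ - n : ℕ) : ℕ∞ω) u := by
    have := Fact.mk (finrank_euclideanSpace_fin (𝕜 := ℝ) (n := n + 1))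
    rw [funext huF]
    exact hF.contMDiff.comp contMDiff_coe_sphere
  have hfC : ContMDiff (𝓡 n) 𝓘(ℝ, ℝ) ((⌊α⌋₊ - n : ℕ) : ℕ∞ω) f := by
    rw [funext hfu]
    intro ξ
    have h1 : ContDiffAt ℝ ((⌊α⌋₊ - n : ℕ) : ℕ∞ω)
        (fun t : ℝ => t ^ (((n : ℝ) + α) / ((n : ℝ) - α))) (u ξ) :=
      contDiffAt_id.rpow_const_of_ne (hu0 ξ).ne'
    exact h1.contMDiffAt.comp ξ (huC ξ)
  have hfadm : f ∈ admissibleClass n :=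
    ⟨hfi, Eventually.of_forall hf0, Eventually.of_forall hfs⟩
  refine ⟨u, f, ⟨⟨hu0, fun ξ => ?_⟩, hus, huC⟩, ⟨hf0, hfs, hfC, hfadm, ?_⟩, hfu⟩
  · simp_rw [← hfu]
    exact hpot ξ
  · intro g hg
    -- Competitors are positive only almost everywhere, while the abstract inequality asks for
    -- nonnegativity everywhere; the positive part changes no integral.
    have hgae : (fun ξ => max (g ξ) 0) =ᵐ[weightedMeasure R] g :=
      (ae_weightedMeasure hg.2.1).mono fun ξ hξ => max_eq_left hξ.le
    have key := hfmin (fun ξ => max (g ξ) 0)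
      (integrable_weightedMeasure hRcont hRpos hg.1).pos_part fun ξ => le_max_right _ _
    have e1 : potential (weightedMeasure R) (evenRieszKernel α) (fun ξ => max (g ξ) 0) =
        potential (weightedMeasure R) (evenRieszKernel α) g := funext fun ξ =>
      integral_congr_ae (hgae.mono fun η hη => by simp only [hη])
    have e2 : pairing (weightedMeasure R) (evenRieszKernel α) (fun ξ => max (g ξ) 0)
        (fun ξ => max (g ξ) 0) = pairing (weightedMeasure R) (evenRieszKernel α) g g := by
      unfold pairing
      rw [e1]
      exact integral_congr_ae (hgae.mono fun η hη => by simp only [hη])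
    have e3 : ∫ ξ, (max (g ξ) 0) ^ p ∂(weightedMeasure R) =
        ∫ ξ, g ξ ^ p ∂(weightedMeasure R) :=
      integral_congr_ae (hgae.mono fun η hη => by simp only [hη])
    rw [e2, e3, hp] at key
    exact quotientJ_le_of_pairing_le hα hn hRcont hRpos hRsymm hfadm hg key
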